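/- Let $\mathbb{A}$ be a finite alphabet, $P^B$ and $P^W$ two probability measures on $\mathbb{A}$, and $\lambda$ a joining of $P^B$ and $P^W$, that is, a probability measure on $\mathbb{A}\times\mathbb{A}$ with marginals $P^B$ and $P^W$. Let $\delta>0$ be a real number, $M$ an integer, and $k\ge 1$ an integer. Consider two processes indexed by $\mathbb{Z}$ with values in the countable set $\mathbb{N}^{\mathbb{A}}\times\mathbb{N}^{\mathbb{A}}$. The process $\xi$: at the sites $x\in\mathbb{Z}$ the numbers of black and of white particles are independent Poisson random variables of parameter $\delta/2$. Each black (respectively white) particle receives, independently of everything else, a label with law $P^B$ (respectively $P^W$). Let $\xi_x=\bigl((\xi^B_x(a))_{a\in\mathbb{A}},(\xi^W_x(b))_{b\in\mathbb{A}}\bigr)$, where $\xi^B_x(a)$ (respectively $\xi^W_x(b)$) is the number of black (respectively white) particles at $x$ with label $a$ (respectively $b$). The process $\zeta$ (which depends on $k$ and $M$): at the sites $x\in\mathbb{Z}$ the numbers of black particles are independent Poisson random variables of parameter $\delta/2$. For each black particle, at position $x$ say, one picks, independently of everything else, an integer $j$ uniformly in $\{M,M+1,\dots,M+k-1\}$ and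 a pair of labels $(a,b)$ with law $\lambda$; the black particle receives the label $a$, and it is linked to a white particle with label $b$ that is put at position $x+j$. All white particles arise in this way. Let $\zeta_x=\bigl((\zeta^B_x(a))_{a\in\mathbb{A}},(\zeta^W_x(b))_{b\in\mathbb{A}}\bigr)$ be the numbers of black and white particles at $x$ by label. For two stationary processes $\xi,\zeta$ with values in a countable set, let $\bar d_L(\xi,\zeta)$, $L\ge1$, be the minimum of the expectation of $\frac1L\#\{1\le i\le L: x_i\ne z_i\}$ over all joint laws of pairs $\bigl((x_1,\dots,x_L),(z_1,\dots,z_L)\bigr)$ whose marginals are the laws of $(\xi_1,\dots,\xi_L)$ and $(\zeta_1,\dots,\zeta_L)$, and let $\bar d(\xi,\zeta)=\sup_{L\ge1}\bar d_L(\xi,\zeta)$. Then, with $\mathbb{A}$, $P^B$, $P^W$, $\lambda$, $\delta$ and $M$ fixed, for every $\varepsilon>0$ there is a $K$ such that $\bar d(\xi,\zeta)<\varepsilon$ for all $k\ge K$ (with $k\ge1$). -/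

import Mathlib

open MeasureTheory ProbabilityTheory
open scoped NNReal ENNReal

namespace ParticlePairs

section DBar

variable {S T : Type*} [MeasurableSpace S] [MeasurableSpace T]

/-- A joining of two probability laws `P` and `Q`: a probability measure on the product space whose
marginals are `P` and `Q`. -/
structure IsJoining (lam : Measure (S × T)) (P : Measure S) (Q : Measure T) : Prop where
  isProbabilityMeasure : IsProbabilityMeasure lam
  map_fst : lam.map Prod.fst = P
  map_snd : lam.map Prod.snd = Q

/-- The law of the block `(x_1, …, x_L)` when `(x_n)_{n ∈ ℤ}` has law `μ`. -/
noncomputable def blockLaw (μ : Measure (ℤ → S)) (L : ℕ) : Measure (Fin L → S) :=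
  μ.map (fun x i => x ((i : ℤ) + 1))

open Classical in
/-- The normalized Hamming distance between two words of length `L`: the proportion of the indices
at which they differ. -/
noncomputable def normalizedHamming {B : Type*} {L : ℕ} (x z : Fin L → B) : ℝ≥0∞ :=
  (hammingDist x z : ℝ≥0∞) / (L : ℝ≥0∞)

/-- The smallest expected normalized Hamming distance among all joinings of the laws of the blocks
of length `L`. The infimum is taken in `[0, ∞]`, so it would be `∞` if there were no joining. -/
noncomputable def dBarBlock (μ ν : Measure (ℤ → S)) (L : ℕ) : ℝ≥0∞ :=
  ⨅ (lam : Measure ((Fin L → S) × (Fin L → S)))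
    (_ : IsJoining lam (blockLaw μ L) (blockLaw ν L)),
    ∫⁻ p, normalizedHamming p.1 p.2 ∂lam

/-- The `d̄`-distance between two stationary processes with laws `μ` and `ν`. -/
noncomputable def dBar (μ ν : Measure (ℤ → S)) : ℝ≥0∞ :=
  ⨆ (L : ℕ) (_ : 1 ≤ L), dBarBlock μ ν L

end DBar

section Processes

variable {A : Type*}

/-- What is observed at one site: `(a ↦ number of black particles with label a,
b ↦ number of white particles with label b)`. -/
abbrev SiteCounts (A : Type*) : Type _ := (A → ℕ) × (A → ℕ)

open Classical in
/-- The number of indices `i < n` such that the label `l i` is `a`. -/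
noncomputable def labelCount (n : ℕ) (l : ℕ → A) (a : A) : ℕ :=
  ((Finset.range n).filter fun i => l i = a).card

/-- Raw data of the disconnected particles: at each site the number of black particles with a
sequence of labels, and the number of white particles with a sequence of labels. When there are `n`
particles of a colour at a site, the first `n` labels of the sequence are theirs and the other
labels are not used. -/
abbrev FreeConfig (A : Type*) : Type _ := ℤ → (ℕ × (ℕ → A)) × (ℕ × (ℕ → A))

/-- The counts of the disconnected particles. -/
noncomputable def freeCounts (ω : FreeConfig A) (x : ℤ) : SiteCounts A :=
  (labelCount (ω x).1.1 (ω x).1.2, labelCount (ω x).2.1 (ω x).2.2)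

/-- Raw data of the linked pairs: at each site `y` the number of black particles and, for the
`i`-th of them, the displacement index `j : Fin k` (its white partner sits at `y + M + j`) and the
labels of the black and of the white particle of the pair. When there are `n` black particles at a
site, the first `n` entries of the sequence are theirs and the other entries are not used. -/
abbrev LinkedConfig (A : Type*) (k : ℕ) : Type _ := ℤ → ℕ × (ℕ → Fin k × (A × A))

open Classical in
/-- The number of black particles at `x` with label `a`. -/
noncomputable def linkedBlackCount {k : ℕ} (ω : LinkedConfig A k) (x : ℤ) (a : A) : ℕ :=
  ((Finset.range (ω x).1).filter fun i => ((ω x).2 i).2.1 = a).card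

open Classical in
/-- The number of white particles at `x` with label `b`: a black particle has its white partner at
`x` exactly if it sits at `x - (M + j)` and has displacement index `j`, for some `j : Fin k`. -/
noncomputable def linkedWhiteCount (M : ℤ) {k : ℕ} (ω : LinkedConfig A k) (x : ℤ) (b : A) : ℕ :=
  ∑ j : Fin k, ((Finset.range (ω (x - (M + (j : ℤ)))).1).filter fun i =>
    ((ω (x - (M + (j : ℤ)))).2 i).1 = j ∧ ((ω (x - (M + (j : ℤ)))).2 i).2.2 = b).card

/-- The counts of the linked particles. -/
noncomputable def linkedCounts (M : ℤ) {k : ℕ} (ω : LinkedConfig A k) (x : ℤ) : SiteCounts A :=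
  (linkedBlackCount ω x, linkedWhiteCount M ω x)

variable [MeasurableSpace A]

/-- The law of the raw data of the disconnected particles: the numbers of black and of white
particles at the sites are independent Poisson variables of parameter `δ / 2`, and, independently
of them and of each other, the labels have law `PB` for black and `PW` for white particles. -/
noncomputable def freeMeasure (δ : ℝ≥0) (PB PW : Measure A)
    [IsProbabilityMeasure PB] [IsProbabilityMeasure PW] : Measure (FreeConfig A) :=
  Measure.infinitePi fun _ : ℤ =>
    ((poissonMeasure (δ / 2)).prod (Measure.infinitePi fun _ : ℕ => PB)).prod
      ((poissonMeasure (δ / 2)).prod (Measure.infinitePi fun _ : ℕ => PW))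

/-- The law of the process `ξ`. -/
noncomputable def xiLaw (δ : ℝ≥0) (PB PW : Measure A)
    [IsProbabilityMeasure PB] [IsProbabilityMeasure PW] : Measure (ℤ → SiteCounts A) :=
  (freeMeasure δ PB PW).map freeCounts

/-- The law of the raw data of the linked pairs: the numbers of black particles at the sites are
independent Poisson variables of parameter `δ / 2`, and, independently of them and of each other,
the displacement indices are uniform on `Fin k` and the pairs of labels have law `lam`. -/
noncomputable def linkedMeasure (δ : ℝ≥0) (lam : Measure (A × A)) [IsProbabilityMeasure lam]
    (k : ℕ) [NeZero k] : Measure (LinkedConfig A k) :=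
  Measure.infinitePi fun _ : ℤ =>
    (poissonMeasure (δ / 2)).prod
      (Measure.infinitePi fun _ : ℕ => (PMF.uniformOfFintype (Fin k)).toMeasure.prod lam)

/-- The law of the process `ζ`. -/
noncomputable def zetaLaw (δ : ℝ≥0) (lam : Measure (A × A)) [IsProbabilityMeasure lam]
    (M : ℤ) (k : ℕ) [NeZero k] : Measure (ℤ → SiteCounts A) :=
  (linkedMeasure δ lam k).map (linkedCounts M)

end Processes

end ParticlePairs

/-! The black counts of the linked process are independent with the same site law as in the free
process, so they can be shared by both, and only the white counts need a coupling.

By Poisson splitting, the numbers of linked pairs, sorted by black site, displacement index and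
label pair, are independent Poisson variables. Fix a site x. The pairs with white partner at x form
a column: index j, black site x - M - j. The past of x, that is, all black counts of the block and
the white counts at its earlier sites, sees such a pair only through its black particle. To the past
it looks like a pair with the same black site and labels but an index j' > j, whose white particle
falls to the right of x. Such substitutes are present anyway, with Poisson rates proportional to
1/k. One extra particle placed among them, with j uniform and then j' uniform above j, is nearly
invisible: the change in total variation is controlled by the square root of Σ q²/rate, which is a
constant times the mean of 1/m over m < k, of order (log k)/k (`sum_measure_add_single_le`,
`sum_spreadWeight_sq`). The column holds δ/2 particles on average, so replacing them one at a time
shows that the whole column is nearly invisible to the past (`close_conv_compoundPoisson`). Hence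
the white counts at x are nearly independent of the past, and their law is that of the free process
(`close_map_prod`, `close_linkedCounts`).

The error τ for one site does not depend on the block length L. Optimal couplings made site by site,
each conditional on the past, give at most Lτ expected mismatches (`exists_isJoining_sequence`), so
every `dBarBlock` is at most τ, and τ tends to 0 as k grows. -/

namespace ParticlePairs

/-! ### Total variation bounds. -/

section Close

variable {α β : Type*} [MeasurableSpace α] [MeasurableSpace β]

/-- The measure `μ` exceeds `ν` by at most `τ` on every measurable set. For probability measures
this says that their total variation distance is at most `τ`. -/
def Close (τ : ℝ≥0∞) (μ ν : Measure α) : Prop :=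
  ∀ s, MeasurableSet s → μ s ≤ ν s + τ

theorem Close.refl (μ : Measure α) : Close 0 μ μ := fun _ _ => by simp

theorem Close.mono {τ τ' : ℝ≥0∞} {μ ν : Measure α} (h : Close τ μ ν) (hτ : τ ≤ τ') :
    Close τ' μ ν := fun s hs => (h s hs).trans (by gcongr)

/-- Pass to complements; equal total mass turns an upper bound into a lower one. -/
theorem Close.symm {τ : ℝ≥0∞} {μ ν : Measure α} [IsProbabilityMeasure μ] [IsProbabilityMeasure ν]
    (h : Close τ μ ν) : Close τ ν μ := by
  intro s hs
  have h1 := h sᶜ hs.compl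
  have h2 : μ s + μ sᶜ = ν s + ν sᶜ := by simp [measure_add_measure_compl hs]
  have h3 : ν s + ν sᶜ ≤ μ s + τ + ν sᶜ := by
    rw [← h2, add_assoc, add_comm τ]
    gcongr
  exact (ENNReal.add_le_add_iff_right (measure_ne_top ν _)).1 h3

theorem Close.trans {τ τ' : ℝ≥0∞} {μ ν ρ : Measure α} (h : Close τ μ ν) (h' : Close τ' ν ρ) :
    Close (τ + τ') μ ρ := fun s hs =>
  (h s hs).trans <| (add_le_add_left (h' s hs) _).trans_eq (by ring)

theorem Close.map {τ : ℝ≥0∞} {μ ν : Measure α} (h : Close τ μ ν) {f : α → β} (hf : Measurable f) :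
    Close τ (μ.map f) (ν.map f) := fun s hs => by
  rw [Measure.map_apply hf hs, Measure.map_apply hf hs]
  exact h _ (hf hs)

theorem Close.prod_right {τ : ℝ≥0∞} {μ ν : Measure α} [SFinite μ] [SFinite ν] (h : Close τ μ ν)
    (ρ : Measure β) [IsProbabilityMeasure ρ] : Close τ (μ.prod ρ) (ν.prod ρ) := fun s hs => by
  rw [Measure.prod_apply_symm hs, Measure.prod_apply_symm hs]
  calc ∫⁻ y, μ ((fun x => (x, y)) ⁻¹' s) ∂ρ
      ≤ ∫⁻ y, (ν ((fun x => (x, y)) ⁻¹' s) + τ) ∂ρ :=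
        lintegral_mono fun y => h _ (measurable_prodMk_right hs)
    _ = _ := by rw [lintegral_add_right _ measurable_const]; simp

theorem Close.conv_right {G : Type*} [AddMonoid G] [MeasurableSpace G] [MeasurableAdd₂ G]
    {τ : ℝ≥0∞} {μ ν : Measure G} [SFinite μ] [SFinite ν] (h : Close τ μ ν)
    (ρ : Measure G) [IsProbabilityMeasure ρ] : Close τ (μ ∗ ρ) (ν ∗ ρ) :=
  (h.prod_right ρ).map measurable_add

end Close

/-! ### Maximal couplings, and their composition along a sequence. -/

section Coupling

/-- Two probability laws on a countable space have a joining that is off the diagonal with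
probability at most `α S - β S` for a suitable set `S`. -/
theorem exists_isJoining_offDiag {T : Type*} [Countable T] [MeasurableSpace T]
    [DiscreteMeasurableSpace T] (α β : Measure T) [IsProbabilityMeasure α]
    [IsProbabilityMeasure β] :
    ∃ γ : Measure (T × T), IsJoining γ α β ∧
      γ {p | p.1 ≠ p.2} + β {t | β {t} < α {t}} ≤ α {t | β {t} < α {t}} := by
  classical
  have hwd (f : T → ℝ≥0∞) (t : T) : (Measure.count.withDensity f) {t} = f t := by
    rw [withDensity_apply _ (by measurability)]; simp
  set S : Set T := {t | β {t} < α {t}}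
  set m : Measure T := Measure.count.withDensity fun t => min (α {t}) (β {t})
  set α' : Measure T := Measure.count.withDensity fun t => α {t} - β {t}
  set β' : Measure T := Measure.count.withDensity fun t => β {t} - α {t}
  have hα : m + α' = α := by
    refine Measure.ext_iff_singleton.2 fun t => ?_
    simp only [Measure.add_apply, m, α', hwd]
    rcases le_total (α {t}) (β {t}) with h | h
    · rw [min_eq_left h, tsub_eq_zero_of_le h, add_zero]
    · rw [min_eq_right h, add_tsub_cancel_of_le h]
  have hβ : m + β' = β := by
    refine Measure.ext_iff_singleton.2 fun t => ?_
    simp only [Measure.add_apply, m, β', hwd]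
    rcases le_total (α {t}) (β {t}) with h | h
    · rw [min_eq_left h, add_tsub_cancel_of_le h]
    · rw [min_eq_right h, tsub_eq_zero_of_le h, add_zero]
  have hα' : m Set.univ + α' Set.univ = 1 := by
    rw [← Measure.add_apply, hα, measure_univ]
  have hβ' : m Set.univ + β' Set.univ = 1 := by
    rw [← Measure.add_apply, hβ, measure_univ]
  have hm : m Set.univ ≠ ∞ := ne_top_of_le_ne_top ENNReal.one_ne_top (hα' ▸ le_self_add)
  have hd : α' Set.univ = β' Set.univ := by
    rw [← hβ'] at hα'
    exact (ENNReal.add_right_inj hm).1 hα'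
  have hd1 : α' Set.univ ≠ ∞ := ne_top_of_le_ne_top ENNReal.one_ne_top (hα' ▸ le_add_self)
  have : IsFiniteMeasure α' := ⟨hd1.lt_top⟩
  have : IsFiniteMeasure β' := ⟨hd ▸ hd1.lt_top⟩
  have : IsFiniteMeasure m := ⟨hm.lt_top⟩
  have hsm (ρ : Measure T) (hρ : ρ Set.univ = α' Set.univ) :
      (α' Set.univ)⁻¹ • α' Set.univ • ρ = ρ := by
    rcases eq_or_ne (α' Set.univ) 0 with h0 | h0
    · rw [h0, Measure.measure_univ_eq_zero] at hρ
      simp [hρ]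
    · rw [smul_smul, ENNReal.inv_mul_cancel h0 hd1, one_smul]
  have hmd : Measurable fun t : T => (t, t) := .of_discrete
  -- The maximal coupling: the common part sits on the diagonal, and the two excesses, of equal
  -- mass, are coupled independently. If that mass is 0 the factor is ∞, but it multiplies the zero
  -- measure.
  set γ : Measure (T × T) := m.map (fun t => (t, t)) + (α' Set.univ)⁻¹ • α'.prod β' with hγ
  have h1 : γ.map Prod.fst = α := by
    rw [hγ, Measure.map_add _ _ measurable_fst, Measure.map_map measurable_fst hmd,
      Measure.map_smul, Measure.map_fst_prod, ← hd, hsm _ rfl]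
    change m.map id + α' = α
    rw [Measure.map_id, hα]
  have h2 : γ.map Prod.snd = β := by
    rw [hγ, Measure.map_add _ _ measurable_snd, Measure.map_map measurable_snd hmd,
      Measure.map_smul, Measure.map_snd_prod, hsm _ hd.symm]
    change m.map id + β' = β
    rw [Measure.map_id, hβ]
  refine ⟨γ, ⟨⟨?_⟩, h1, h2⟩, ?_⟩
  · rw [← Set.preimage_univ (f := Prod.fst), ← Measure.map_apply measurable_fst .univ, h1,
      measure_univ]
  · have hoff : γ {p | p.1 ≠ p.2} ≤ α' Set.univ := by
      rw [hγ, Measure.add_apply, Measure.map_apply hmd (.of_discrete)]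
      simp only [Set.preimage_ofPred_eq, ne_eq, not_true_eq_false, Set.ofPred_false, measure_empty,
        zero_add, Measure.smul_apply, smul_eq_mul]
      calc _ ≤ (α' Set.univ)⁻¹ * (α'.prod β') Set.univ := by gcongr; simp
        _ = ((α' Set.univ)⁻¹ * α' Set.univ) * α' Set.univ := by
          rw [← Set.univ_prod_univ, Measure.prod_prod, ← hd, mul_assoc]
        _ ≤ 1 * α' Set.univ := by gcongr; exact ENNReal.inv_mul_le_one _
        _ = _ := one_mul _
    have hSc : α' Sᶜ = 0 := by
      rw [withDensity_apply _ .of_discrete, lintegral_eq_zero_iff .of_discrete]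
      refine (ae_restrict_iff' .of_discrete).2 (.of_forall fun t ht => ?_)
      exact tsub_eq_zero_of_le (not_lt.1 ht)
    have hS : α' Set.univ = α' S := by
      rw [← measure_add_measure_compl (μ := α') (s := S) .of_discrete, hSc, add_zero]
    have hSβ : β' S = 0 := by
      rw [withDensity_apply _ .of_discrete, lintegral_eq_zero_iff .of_discrete]
      refine (ae_restrict_iff' .of_discrete).2 (.of_forall fun t ht => ?_)
      exact tsub_eq_zero_of_le (le_of_lt ht)
    calc γ {p | p.1 ≠ p.2} + β S ≤ α' S + (m + β') S := by rw [hβ, ← hS]; gcongr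
      _ = α S := by rw [← hα, Measure.add_apply, Measure.add_apply, hSβ, add_zero, add_comm]

/-- Extension of a joining of `P.fst` and `p'` by one more coordinate. -/
theorem exists_isJoining_prod {H H' T : Type*} [Countable H] [Countable H'] [Countable T]
    [MeasurableSpace H] [MeasurableSpace H'] [MeasurableSpace T]
    [DiscreteMeasurableSpace H] [DiscreteMeasurableSpace H'] [DiscreteMeasurableSpace T]
    {P : Measure (H × T)} [IsProbabilityMeasure P] {p' : Measure H'}
    {ν : Measure T} [IsProbabilityMeasure ν] {τ : ℝ≥0∞} (hP : Close τ P (P.fst.prod ν))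
    {π : Measure (H × H')} (hπ : IsJoining π P.fst p') :
    ∃ ρ : Measure ((H × T) × (H' × T)), IsJoining ρ P (p'.prod ν) ∧
      ρ.map (fun q => (q.1.1, q.2.1)) = π ∧ ρ {q | q.1.2 ≠ q.2.2} ≤ τ := by
  have : Nonempty T := ν.nonempty_of_neZero
  have := hπ.isProbabilityMeasure
  set c := P.condKernel
  choose γ hγ hγS using fun h => exists_isJoining_offDiag (c h) ν
  -- The coupling over (h, h') ignores h'. Its second coordinate has law `ν` for every (h, h'), so
  -- it is independent of h'.
  set κ : Kernel (H × H') (T × T) := ⟨fun h => γ h.1, .of_discrete⟩ with hκ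
  have hκa (h : H × H') : κ h = γ h.1 := rfl
  have : IsMarkovKernel κ := ⟨fun h => (hγ h.1).isProbabilityMeasure⟩
  set f : (H × H') × (T × T) → (H × T) × (H' × T) := fun q => ((q.1.1, q.2.1), (q.1.2, q.2.2))
  have hf : Measurable f := .of_discrete
  have hfst (g : H → ℝ≥0∞) : ∫⁻ h, g h.1 ∂π = ∫⁻ h, g h ∂P.fst := by
    rw [← hπ.map_fst, lintegral_map .of_discrete measurable_fst]
  have hsnd (g : H' → ℝ≥0∞) : ∫⁻ h, g h.2 ∂π = ∫⁻ h, g h ∂p' := by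
    rw [← hπ.map_snd, lintegral_map .of_discrete measurable_snd]
  have : IsProbabilityMeasure p' := by
    rw [← hπ.map_snd]; exact Measure.isProbabilityMeasure_map measurable_snd.aemeasurable
  have hPs (s : Set (H × T)) : P s = ∫⁻ h, c h (Prod.mk h ⁻¹' s) ∂P.fst := by
    conv_lhs => rw [← P.disintegrate c]
    rw [Measure.compProd_apply .of_discrete]
  refine ⟨(π ⊗ₘ κ).map f, ⟨Measure.isProbabilityMeasure_map hf.aemeasurable, ?_, ?_⟩, ?_, ?_⟩
  · rw [Measure.map_map measurable_fst hf]
    ext s hs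
    rw [Measure.map_apply (measurable_fst.comp hf) hs, Measure.compProd_apply .of_discrete]
    rw [hPs, ← hfst fun h => c h (Prod.mk h ⁻¹' s)]
    refine lintegral_congr fun h => ?_
    rw [hκa, ← (hγ h.1).map_fst, Measure.map_apply measurable_fst .of_discrete]
    rfl
  · rw [Measure.map_map measurable_snd hf]
    ext s hs
    rw [Measure.map_apply (measurable_snd.comp hf) hs, Measure.compProd_apply .of_discrete,
      Measure.prod_apply hs, ← hsnd fun h => ν (Prod.mk h ⁻¹' s)]
    refine lintegral_congr fun h => ?_
    rw [hκa, ← (hγ h.1).map_snd, Measure.map_apply measurable_snd .of_discrete]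
    rfl
  · rw [Measure.map_map .of_discrete hf]
    exact Measure.fst_compProd π κ
  -- The optimal sets of the fibres glue to a single set, to which `hP` is applied once. The
  -- additive form of the fibre bound allows integration before the cancellation.
  · set S : Set (H × T) := {q | ν {q.2} < c q.1 {q.2}}
    have h1 : ((π ⊗ₘ κ).map f) {q | q.1.2 ≠ q.2.2} + (P.fst.prod ν) S ≤ P S := by
      rw [Measure.map_apply hf .of_discrete, Measure.compProd_apply .of_discrete,
        Measure.prod_apply .of_discrete, hPs, ← hfst, ← hfst, ← lintegral_add_right _ .of_discrete]
      exact lintegral_mono fun h => hγS h.1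
    have h2 := h1.trans (hP S .of_discrete)
    rw [add_comm] at h2
    exact (ENNReal.add_le_add_iff_left (measure_ne_top _ _)).1 h2

open Classical in
theorem hammingDist_snoc {T : Type*} {n : ℕ} (w w' : Fin n → T) (t t' : T) :
    hammingDist (Fin.snoc w t : Fin (n + 1) → T) (Fin.snoc w' t') =
      hammingDist w w' + if t ≠ t' then 1 else 0 := by
  simp [hammingDist, Finset.card_filter, Fin.sum_univ_castSucc]

open Classical in
/-- If, for each `i < L`, the variable `W i` is nearly independent of `(B, W 0, …, W (i - 1))` with
law nearly `ν`, then `(B, W 0, …, W (L - 1))` can be joined with an independent sequence of law `ν`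
attached to the same `B`, with few expected differences. -/
theorem exists_isJoining_sequence {Ω E T : Type*} [MeasurableSpace Ω] [Countable E] [Countable T]
    [MeasurableSpace E] [MeasurableSpace T] [DiscreteMeasurableSpace E] [DiscreteMeasurableSpace T]
    (μ : Measure Ω) [IsProbabilityMeasure μ] {B : Ω → E} (hB : Measurable B)
    {W : ℕ → Ω → T} (hW : ∀ i, Measurable (W i)) (ν : Measure T) [IsProbabilityMeasure ν]
    (τ : ℝ≥0∞) (L : ℕ)
    (h : ∀ i < L, Close τ (μ.map fun ω => ((B ω, fun j : Fin i => W j ω), W i ω))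
      ((μ.map fun ω => (B ω, fun j : Fin i => W j ω)).prod ν)) :
    ∃ π : Measure ((E × (Fin L → T)) × (E × (Fin L → T))),
      IsJoining π (μ.map fun ω => (B ω, fun j : Fin L => W j ω))
        ((μ.map B).prod (Measure.pi fun _ : Fin L => ν)) ∧
      (∀ᵐ p ∂π, p.1.1 = p.2.1) ∧
      ∫⁻ p, (hammingDist p.1.2 p.2.2 : ℝ≥0∞) ∂π ≤ L * τ := by
  have hH (i : ℕ) : Measurable fun ω => (B ω, fun j : Fin i => W j ω) := by fun_prop
  induction L with
  | zero =>
    set P := μ.map fun ω => (B ω, fun j : Fin 0 => W j ω) with hP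
    have hP1 : IsProbabilityMeasure P := Measure.isProbabilityMeasure_map (hH 0).aemeasurable
    have hd : Measurable fun x : E × (Fin 0 → T) => (x, x) := .of_discrete
    refine ⟨P.map fun x => (x, x), ⟨Measure.isProbabilityMeasure_map hd.aemeasurable, ?_, ?_⟩,
      ?_, ?_⟩
    · rw [Measure.map_map measurable_fst hd]; exact Measure.map_id
    · rw [Measure.map_map measurable_snd hd]
      change P.map id = _
      rw [Measure.map_id, Measure.pi_of_empty (fun _ : Fin 0 => ν) (fun j => j.elim0),
        Measure.prod_dirac, Measure.map_map .of_discrete hB, hP]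
      congr 1
      funext ω
      exact Prod.ext rfl (Subsingleton.elim _ _)
    · rw [ae_map_iff hd.aemeasurable .of_discrete]; simp
    · rw [lintegral_map .of_discrete hd]; simp
  | succ n ih =>
    obtain ⟨π, hπ, hπB, hπd⟩ := ih fun i hi => h i (by omega)
    have hP := h n (by omega)
    set P := μ.map fun ω => ((B ω, fun j : Fin n => W j ω), W n ω) with hPdef
    have hPm : Measurable fun ω => ((B ω, fun j : Fin n => W j ω), W n ω) := (hH n).prodMk (hW n)
    have hP1 : IsProbabilityMeasure P := Measure.isProbabilityMeasure_map hPm.aemeasurable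
    have hfst : P.fst = μ.map fun ω => (B ω, fun j : Fin n => W j ω) :=
      Measure.map_map measurable_fst hPm
    rw [← hfst] at hP hπ
    obtain ⟨ρ, hρ, hρπ, hρτ⟩ := exists_isJoining_prod hP hπ
    have := hρ.isProbabilityMeasure
    have : IsProbabilityMeasure (μ.map B) := Measure.isProbabilityMeasure_map hB.aemeasurable
    set F : (E × (Fin n → T)) × T → E × (Fin (n + 1) → T) := fun x => (x.1.1, Fin.snoc x.1.2 x.2)
      with hF
    have hFm : Measurable F := .of_discrete
    have hFF : Measurable (Prod.map F F) := .of_discrete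
    refine ⟨ρ.map (Prod.map F F), ⟨Measure.isProbabilityMeasure_map hFF.aemeasurable, ?_, ?_⟩,
      ?_, ?_⟩
    · rw [Measure.map_map measurable_fst hFF]
      change ρ.map (F ∘ Prod.fst) = _
      rw [← Measure.map_map hFm measurable_fst, hρ.map_fst, hPdef, Measure.map_map hFm hPm]
      congr 1
      funext ω
      refine Prod.ext rfl (funext fun j => ?_)
      induction j using Fin.lastCases <;> simp [hF]
    · rw [Measure.map_map measurable_snd hFF]
      change ρ.map (F ∘ Prod.snd) = _
      rw [← Measure.map_map hFm measurable_snd, hρ.map_snd]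
      refine Measure.ext_iff_singleton.2 fun ⟨b, w⟩ => ?_
      have hpre : F ⁻¹' {(b, w)} =
          ({b} ×ˢ {fun j : Fin n => w j.castSucc}) ×ˢ {w (Fin.last n)} := by
        ext ⟨⟨b', w'⟩, t⟩
        simp only [hF, Set.mem_preimage, Set.mem_singleton_iff, Prod.mk.injEq, Set.mem_prod,
          and_assoc]
        refine and_congr_right fun _ => ⟨?_, ?_⟩
        · rintro rfl; simp
        · rintro ⟨rfl, rfl⟩
          funext j
          induction j using Fin.lastCases <;> simp
      rw [Measure.map_apply hFm .of_discrete, hpre, Measure.prod_prod, Measure.prod_prod,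
        ← Set.singleton_prod_singleton, Measure.prod_prod, Measure.pi_singleton,
        Measure.pi_singleton, Fin.prod_univ_castSucc, mul_assoc]
    · rw [ae_map_iff hFF.aemeasurable .of_discrete]
      rw [← hρπ, ae_map_iff .of_discrete .of_discrete] at hπB
      exact hπB
    · rw [lintegral_map .of_discrete hFF]
      simp only [Prod.map_fst, Prod.map_snd, hF, hammingDist_snoc, Nat.cast_add]
      rw [lintegral_add_left .of_discrete]
      rw [← hρπ, lintegral_map .of_discrete .of_discrete] at hπd
      rw [add_mul, Nat.cast_one, one_mul]
      refine add_le_add hπd ?_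
      refine le_trans (le_of_eq ?_) hρτ
      rw [← lintegral_indicator_one .of_discrete]
      refine lintegral_congr fun q => ?_
      by_cases hq : q.1.2 = q.2.2 <;> simp [hq, Set.indicator]

end Coupling

/-! ### Convolution powers and compound Poisson laws. -/

section CompoundPoisson

variable {G G' : Type*} [AddCommMonoid G] [MeasurableSpace G] [MeasurableAdd₂ G]
  [AddCommMonoid G'] [MeasurableSpace G'] [MeasurableAdd₂ G']

/-- The `n`-fold convolution power of a measure. -/
noncomputable def convPow (κ : Measure G) : ℕ → Measure G
  | 0 => Measure.dirac 0
  | n + 1 => convPow κ n ∗ κ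

instance (κ : Measure G) [IsProbabilityMeasure κ] (n : ℕ) : IsProbabilityMeasure (convPow κ n) := by
  induction n with
  | zero => exact Measure.dirac.isProbabilityMeasure
  | succ n ih => rw [convPow]; infer_instance

/-- The law of the sum of a Poisson number of independent variables of law `κ`. -/
noncomputable def compoundPoisson (r : ℝ≥0) (κ : Measure G) : Measure G :=
  Measure.sum fun n => poissonMeasure r {n} • convPow κ n

omit [MeasurableAdd₂ G] in
theorem compoundPoisson_apply (r : ℝ≥0) (κ : Measure G) {s : Set G} (hs : MeasurableSet s) :
    compoundPoisson r κ s = ∫⁻ n, convPow κ n s ∂poissonMeasure r := by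
  rw [compoundPoisson, Measure.sum_apply _ hs, lintegral_countable']
  simp [mul_comm]

instance (r : ℝ≥0) (κ : Measure G) [IsProbabilityMeasure κ] :
    IsProbabilityMeasure (compoundPoisson r κ) :=
  ⟨by rw [compoundPoisson_apply _ _ .univ]; simp⟩

theorem convPow_map (κ : Measure G) [IsProbabilityMeasure κ] (φ : G →+ G') (hφ : Measurable φ)
    (n : ℕ) : (convPow κ n).map φ = convPow (κ.map φ) n := by
  induction n with
  | zero => rw [convPow, convPow, Measure.map_dirac' hφ, map_zero]
  | succ n ih => rw [convPow, convPow, Measure.map_conv_addMonoidHom φ hφ, ih]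

theorem compoundPoisson_map (r : ℝ≥0) (κ : Measure G) [IsProbabilityMeasure κ] (φ : G →+ G')
    (hφ : Measurable φ) : (compoundPoisson r κ).map φ = compoundPoisson r (κ.map φ) := by
  ext s hs
  rw [Measure.map_apply hφ hs, compoundPoisson_apply _ _ (hφ hs), compoundPoisson_apply _ _ hs]
  refine lintegral_congr fun n => ?_
  rw [← Measure.map_apply hφ hs, convPow_map _ _ hφ]

theorem map_sum_infinitePi {X : Type*} [MeasurableSpace X] (m : Measure X) [IsProbabilityMeasure m]
    {f : X → G} (hf : Measurable f) (n : ℕ) :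
    (Measure.infinitePi fun _ : ℕ => m).map (fun l => ∑ i ∈ Finset.range n, f (l i)) =
      convPow (m.map f) n := by
  induction n with
  | zero => simp [convPow]
  | succ n ih =>
    have hi : iIndepFun (fun (i : ℕ) (l : ℕ → X) => f (l i)) (Measure.infinitePi fun _ : ℕ => m) :=
      iIndepFun_infinitePi (X := fun _ => f) fun _ => hf
    have hm (i : ℕ) : Measurable fun l : ℕ → X => f (l i) := by fun_prop
    have h2 := (hi.indepFun_sum_range_succ hm n).map_add_eq_map_conv_map
      (by rw [Finset.sum_fn]; exact Finset.measurable_sum _ fun i _ => hm i) (hm n)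
    have h3 : (Measure.infinitePi fun _ : ℕ => m).map (fun l => f (l n)) = m.map f := by
      conv_rhs => rw [← Measure.infinitePi_map_eval (fun _ : ℕ => m) n]
      rw [Measure.map_map hf (by fun_prop)]
      rfl
    rw [convPow, ← ih, ← h3]
    convert h2 using 2
    · funext l; simp [Finset.sum_range_succ]
    · congr 1; funext l; simp

theorem map_sum_poisson_prod {X : Type*} [MeasurableSpace X] (r : ℝ≥0) (m : Measure X)
    [IsProbabilityMeasure m] {f : X → G} (hf : Measurable f) :
    ((poissonMeasure r).prod (Measure.infinitePi fun _ : ℕ => m)).map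
      (fun p => ∑ i ∈ Finset.range p.1, f (p.2 i)) = compoundPoisson r (m.map f) := by
  have hF : Measurable fun p : ℕ × (ℕ → X) => ∑ i ∈ Finset.range p.1, f (p.2 i) :=
    measurable_from_prod_countable_right fun n => by
      simp only
      exact Finset.measurable_sum _ fun i _ => hf.comp (measurable_pi_apply i)
  ext s hs
  rw [Measure.map_apply hF hs, Measure.prod_apply (hF hs), compoundPoisson_apply _ _ hs]
  refine lintegral_congr fun n => ?_
  rw [← map_sum_infinitePi m hf, Measure.map_apply _ hs]
  · rfl
  · exact Finset.measurable_sum _ fun i _ => hf.comp (measurable_pi_apply i)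

/-- Replace the factors one at a time. The laws `κ` and `κ'` need not be close by themselves, only
after smoothing by `U`; commutativity keeps `U` next to the factor being replaced. -/
theorem close_conv_convPow {τ : ℝ≥0∞} {U κ κ' : Measure G} [IsProbabilityMeasure U]
    [IsProbabilityMeasure κ] [IsProbabilityMeasure κ'] (h : Close τ (U ∗ κ) (U ∗ κ')) (n : ℕ) :
    Close (n * τ) (U ∗ convPow κ n) (U ∗ convPow κ' n) := by
  induction n with
  | zero => simpa [convPow] using Close.refl U
  | succ n ih =>
    have h1 := h.conv_right (convPow κ n)
    have h2 := ih.conv_right κ'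
    rw [Measure.conv_assoc, Measure.conv_comm κ, Measure.conv_assoc, Measure.conv_comm κ',
      ← Measure.conv_assoc U _ κ'] at h1
    rw [Measure.conv_assoc U (convPow κ' n)] at h2
    refine (h1.trans h2).mono (le_of_eq ?_)
    push_cast
    ring

end CompoundPoisson

/-! ### Moments of the Poisson law, and averaging over a Poisson number of factors. -/

section Poisson

theorem poissonMeasure_singleton' (r : ℝ≥0) (n : ℕ) :
    poissonMeasure r {n} =
      ENNReal.ofReal (Real.exp (-r)) * ((r : ℝ≥0∞) ^ n / (n.factorial : ℝ≥0∞)) := by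
  rw [poissonMeasure_singleton, mul_div_assoc, ENNReal.ofReal_mul (Real.exp_nonneg _),
    ENNReal.ofReal_div_of_pos (by positivity), ENNReal.ofReal_pow r.coe_nonneg]
  simp

theorem poissonMeasure_singleton_succ (r : ℝ≥0) (n : ℕ) :
    poissonMeasure r {n + 1} * (n + 1 : ℕ) = poissonMeasure r {n} * r := by
  have h0 : ((n + 1 : ℕ) : ℝ≥0∞) ≠ 0 := by simp
  have h1 : ((n + 1 : ℕ) : ℝ≥0∞) ≠ ∞ := ENNReal.natCast_ne_top _
  rw [poissonMeasure_singleton', poissonMeasure_singleton', Nat.factorial_succ, pow_succ]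
  simp only [div_eq_mul_inv, Nat.cast_mul]
  rw [ENNReal.mul_inv (.inl h0) (.inl h1)]
  calc _ = ENNReal.ofReal (Real.exp (-r)) * ((r : ℝ≥0∞) ^ n * r * (n.factorial : ℝ≥0∞)⁻¹) *
        (((n + 1 : ℕ) : ℝ≥0∞)⁻¹ * (n + 1 : ℕ)) := by ring
    _ = _ := by rw [ENNReal.inv_mul_cancel h0 h1]; ring

/-- The Mecke (Chen–Stein) identity, from (n + 1) p(n + 1) = r p(n). It yields the first two
moments. -/
theorem lintegral_poissonMeasure_mul (r : ℝ≥0) (f : ℕ → ℝ≥0∞) :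
    ∫⁻ n, f n * n ∂poissonMeasure r = r * ∫⁻ n, f (n + 1) ∂poissonMeasure r := by
  rw [lintegral_countable', lintegral_countable', tsum_eq_zero_add' ENNReal.summable,
    ← ENNReal.tsum_mul_left]
  simp only [CharP.cast_eq_zero, mul_zero, zero_mul, zero_add]
  refine tsum_congr fun n => ?_
  rw [mul_assoc, mul_comm (_ : ℝ≥0∞) (poissonMeasure r _), poissonMeasure_singleton_succ]
  ring

theorem lintegral_poissonMeasure_id (r : ℝ≥0) : ∫⁻ n, (n : ℝ≥0∞) ∂poissonMeasure r = r := by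
  simpa using lintegral_poissonMeasure_mul r fun _ => 1

theorem lintegral_poissonMeasure_sq (r : ℝ≥0) :
    ∫⁻ n, (n : ℝ≥0∞) ^ 2 ∂poissonMeasure r = r * (r + 1) := by
  have h := lintegral_poissonMeasure_mul r fun n => (n : ℝ≥0∞)
  simp only [Nat.cast_add, Nat.cast_one] at h
  rw [lintegral_add_right _ measurable_const, lintegral_poissonMeasure_id] at h
  simpa [sq] using h

theorem memLp_natCast_poissonMeasure (r : ℝ≥0) :
    MemLp (fun n : ℕ => (n : ℝ)) 2 (poissonMeasure r) := by
  refine ⟨.of_discrete, ?_⟩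
  rw [eLpNorm_lt_top_iff_lintegral_rpow_enorm_lt_top (by simp) (by simp)]
  have : ∀ n : ℕ, ‖(n : ℝ)‖ₑ ^ (2 : ℝ≥0∞).toReal = (n : ℝ≥0∞) ^ 2 := fun n => by
    simp
  simp only [this, lintegral_poissonMeasure_sq]
  exact ENNReal.mul_lt_top (by simp) (by simp)

theorem integral_natCast_poissonMeasure (r : ℝ≥0) :
    ∫ n : ℕ, (n : ℝ) ∂poissonMeasure r = r := by
  rw [integral_eq_lintegral_of_nonneg_ae (.of_forall fun n => by positivity) .of_discrete]
  simp [lintegral_poissonMeasure_id]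

theorem integral_natCast_sq_poissonMeasure (r : ℝ≥0) :
    ∫ n : ℕ, (n : ℝ) ^ 2 ∂poissonMeasure r = r * (r + 1) := by
  rw [integral_eq_lintegral_of_nonneg_ae (.of_forall fun n => by positivity) .of_discrete]
  have : ∀ n : ℕ, ENNReal.ofReal ((n : ℝ) ^ 2) = (n : ℝ≥0∞) ^ 2 := fun n => by
    rw [ENNReal.ofReal_pow (by positivity)]; simp
  simp only [this, lintegral_poissonMeasure_sq]
  simp [ENNReal.toReal_add]

theorem variance_natCast_poissonMeasure (r : ℝ≥0) :
    Var[fun n : ℕ => (n : ℝ); poissonMeasure r] = r := by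
  rw [variance_eq_sub (memLp_natCast_poissonMeasure r)]
  simp only [Pi.pow_apply]
  rw [integral_natCast_sq_poissonMeasure, integral_natCast_poissonMeasure]
  ring

/-- Given n factors the error is nτ, and the mean of n is `r`. -/
theorem close_conv_compoundPoisson {G : Type*} [AddCommMonoid G] [MeasurableSpace G]
    [MeasurableAdd₂ G] (r : ℝ≥0) {τ : ℝ≥0∞} {U κ κ' : Measure G} [IsProbabilityMeasure U]
    [IsProbabilityMeasure κ] [IsProbabilityMeasure κ'] (h : Close τ (U ∗ κ) (U ∗ κ')) :
    Close (r * τ) (U ∗ compoundPoisson r κ) (U ∗ compoundPoisson r κ') := by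
  have key (κ : Measure G) [IsProbabilityMeasure κ] {s : Set G} (hs : MeasurableSet s) :
      (U ∗ compoundPoisson r κ) s = ∫⁻ n, (U ∗ convPow κ n) s ∂poissonMeasure r := by
    have hc (ρ : Measure G) [IsProbabilityMeasure ρ] :
        (U ∗ ρ) s = ∫⁻ x, ρ ((fun y => x + y) ⁻¹' s) ∂U := by
      rw [Measure.conv, Measure.map_apply measurable_add hs, Measure.prod_apply (measurable_add hs)]
      rfl
    simp_rw [hc, fun x => compoundPoisson_apply r κ (measurable_const_add x hs)]
    refine lintegral_lintegral_swap (Measurable.aemeasurable ?_)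
    exact measurable_from_prod_countable_left fun n =>
      measurable_measure_prodMk_left (ν := convPow κ n) (measurable_add hs)
  intro s hs
  rw [key κ hs, key κ' hs]
  calc _ ≤ ∫⁻ n : ℕ, ((U ∗ convPow κ' n) s + n * τ) ∂poissonMeasure r :=
        lintegral_mono fun n => close_conv_convPow h n s hs
    _ = _ := by
      rw [lintegral_add_left .of_discrete, lintegral_mul_const _ .of_discrete,
        lintegral_poissonMeasure_id]

end Poisson

/-! ### Poisson splitting. -/

section Splitting

variable {X : Type*} [Fintype X] [DecidableEq X] [MeasurableSpace X] [DiscreteMeasurableSpace X]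

/-- The weight `∏ x, m {x} ^ c x / (c x)!` of a vector of counts. -/
noncomputable def multinomialWeight (m : Measure X) (c : X → ℕ) : ℝ≥0∞ :=
  ∏ x, (m {x} ^ c x / ((c x).factorial : ℝ≥0∞))

omit [DiscreteMeasurableSpace X] in
theorem multinomialWeight_add_single (m : Measure X) (d : X → ℕ) (x : X) :
    multinomialWeight m (d + Pi.single x 1) * (d x + 1 : ℕ) = multinomialWeight m d * m {x} := by
  have h0 : ((d x + 1 : ℕ) : ℝ≥0∞) ≠ 0 := by simp
  have h1 : ((d x + 1 : ℕ) : ℝ≥0∞) ≠ ∞ := ENNReal.natCast_ne_top _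
  rw [multinomialWeight, multinomialWeight, ← Finset.mul_prod_erase _ _ (Finset.mem_univ x),
    ← Finset.mul_prod_erase _ (fun y => m {y} ^ d y / _) (Finset.mem_univ x)]
  have h2 : ∏ y ∈ Finset.univ.erase x, (m {y} ^ (d + Pi.single x 1 : X → ℕ) y /
      (((d + Pi.single x 1 : X → ℕ) y).factorial : ℝ≥0∞)) =
      ∏ y ∈ Finset.univ.erase x, (m {y} ^ d y / ((d y).factorial : ℝ≥0∞)) := by
    refine Finset.prod_congr rfl fun y hy => ?_
    simp [Finset.ne_of_mem_erase hy]
  rw [h2]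
  simp only [Pi.add_apply, Pi.single_eq_same, Nat.factorial_succ, Nat.cast_mul, div_eq_mul_inv]
  rw [ENNReal.mul_inv (.inl h0) (.inl h1), pow_succ]
  calc _ = m {x} ^ d x * m {x} * ((d x).factorial : ℝ≥0∞)⁻¹ *
        (∏ y ∈ Finset.univ.erase x, (m {y} ^ d y * ((d y).factorial : ℝ≥0∞)⁻¹)) *
        (((d x + 1 : ℕ) : ℝ≥0∞)⁻¹ * (d x + 1 : ℕ)) := by ring
    _ = _ := by rw [ENNReal.inv_mul_cancel h0 h1]; ring

theorem convPow_single_singleton (m : Measure X) [IsProbabilityMeasure m] (n : ℕ) (c : X → ℕ) :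
    convPow (m.map fun x => (Pi.single x 1 : X → ℕ)) n {c} =
      if ∑ x, c x = n then (n.factorial : ℝ≥0∞) * multinomialWeight m c else 0 := by
  have hs : Measurable fun x : X => (Pi.single x 1 : X → ℕ) := .of_discrete
  have : IsProbabilityMeasure (m.map fun x => (Pi.single x 1 : X → ℕ)) :=
    Measure.isProbabilityMeasure_map hs.aemeasurable
  induction n generalizing c with
  | zero =>
    rw [convPow, Measure.dirac_apply' _ (measurableSet_singleton c)]
    by_cases hc : c = 0
    · subst hc; simp [multinomialWeight]
    · have : ¬ ∑ x, c x = 0 := fun h => hc <| funext fun x => by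
        simpa using (Finset.sum_eq_zero_iff.1 h) x (Finset.mem_univ x)
      rw [if_neg this]
      exact Set.indicator_of_notMem (fun h => hc (Set.mem_singleton_iff.1 h).symm) _
  | succ n ih =>
    rw [convPow, Measure.conv_comm, Measure.conv, Measure.map_apply measurable_add .of_discrete,
      Measure.prod_apply .of_discrete, lintegral_map .of_discrete hs, lintegral_fintype]
    -- Condition on the label x of one particle and remove it. The resulting factors c x add up to n
    -- + 1 and turn n! into (n + 1)!.
    have hterm (x : X) : convPow (m.map fun x => (Pi.single x 1 : X → ℕ)) n
        (Prod.mk (Pi.single x 1) ⁻¹' ((fun p => p.1 + p.2) ⁻¹' {c})) * m {x} =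
        if ∑ x, c x = n + 1 then (n.factorial : ℝ≥0∞) * multinomialWeight m c * c x else 0 := by
      rcases Nat.eq_zero_or_pos (c x) with h0 | hpos
      · have : (Prod.mk (Pi.single x 1) ⁻¹' ((fun p : (X → ℕ) × (X → ℕ) => p.1 + p.2) ⁻¹' {c})) =
            ∅ := by
          refine Set.eq_empty_of_forall_notMem fun d hd => ?_
          have := congrFun (Set.mem_singleton_iff.1 hd) x
          simp [h0] at this
        rw [this]
        simp [h0]
      · obtain ⟨d, rfl⟩ : ∃ d : X → ℕ, d + Pi.single x 1 = c := by
          refine ⟨c - Pi.single x 1, funext fun y => ?_⟩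
          by_cases hy : y = x
          · subst hy; simp; omega
          · simp [hy]
        have : (Prod.mk (Pi.single x 1) ⁻¹' ((fun p : (X → ℕ) × (X → ℕ) => p.1 + p.2) ⁻¹'
            {d + Pi.single x 1})) = {d} := by
          ext e
          simp only [Set.mem_preimage, Set.mem_singleton_iff]
          rw [add_comm, add_left_inj]
        rw [this, ih]
        simp only [Pi.add_apply, Finset.sum_add_distrib, Finset.sum_pi_single', Finset.mem_univ,
          if_true, add_left_inj, Pi.single_eq_same, ite_mul, zero_mul]
        rw [mul_assoc, mul_assoc, multinomialWeight_add_single]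
    simp_rw [hterm]
    by_cases hc : ∑ x, c x = n + 1
    · simp only [hc, if_true]
      rw [← Finset.mul_sum, ← Nat.cast_sum, hc, Nat.factorial_succ]
      push_cast
      ring
    · simp [hc]

/-- Splitting a Poisson number of particles by independent labels gives independent Poisson
variables. -/
theorem compoundPoisson_single (r : ℝ≥0) (m : Measure X) [IsProbabilityMeasure m] :
    compoundPoisson r (m.map fun x => (Pi.single x 1 : X → ℕ)) =
      Measure.pi fun x => poissonMeasure (r * (m {x}).toNNReal) := by
  refine Measure.ext_iff_singleton.2 fun c => ?_
  rw [compoundPoisson_apply _ _ .of_discrete, lintegral_countable']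
  simp_rw [convPow_single_singleton]
  rw [tsum_eq_single (∑ x, c x) (by intro n hn; simp [hn.symm]), if_pos rfl, Measure.pi_singleton]
  simp_rw [poissonMeasure_singleton']
  have hf0 : ((∑ x, c x).factorial : ℝ≥0∞) ≠ 0 := by
    exact_mod_cast Nat.factorial_ne_zero _
  have hexp : ENNReal.ofReal (Real.exp (-r)) =
      ∏ x, ENNReal.ofReal (Real.exp (-(r * (m {x}).toNNReal : ℝ≥0))) := by
    rw [← ENNReal.ofReal_prod_of_nonneg fun _ _ => (Real.exp_pos _).le, ← Real.exp_sum,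
      Finset.sum_neg_distrib]
    congr 3
    have h1 : ∑ x, m {x} = 1 := by
      rw [← measure_univ (μ := m), ← Finset.coe_univ, ← sum_measure_singleton]
    have h2 : ∑ x, (m {x}).toNNReal = 1 := by
      rw [← ENNReal.toNNReal_sum fun x _ => measure_ne_top m _, h1]; rfl
    rw [← NNReal.coe_sum, ← Finset.mul_sum, h2, mul_one]
  rw [hexp, Finset.prod_mul_distrib, multinomialWeight]
  have hpow : ∏ x, (((r * (m {x}).toNNReal : ℝ≥0) : ℝ≥0∞) ^ c x / ((c x).factorial : ℝ≥0∞)) =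
      (r : ℝ≥0∞) ^ (∑ x, c x) * ∏ x, (m {x} ^ c x / ((c x).factorial : ℝ≥0∞)) := by
    rw [← Finset.prod_pow_eq_pow_sum, ← Finset.prod_mul_distrib]
    refine Finset.prod_congr rfl fun x _ => ?_
    rw [ENNReal.coe_mul, ENNReal.coe_toNNReal (measure_ne_top m _), mul_pow, mul_div_assoc]
  rw [hpow]
  simp only [div_eq_mul_inv]
  generalize (∏ x, ENNReal.ofReal (Real.exp (-(r * (m {x}).toNNReal : ℝ≥0)))) = e
  generalize (∏ x, (m {x} ^ c x * ((c x).factorial : ℝ≥0∞)⁻¹)) = w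
  calc _ = ((∑ x, c x).factorial : ℝ≥0∞) * ((∑ x, c x).factorial : ℝ≥0∞)⁻¹ *
        (e * ((r : ℝ≥0∞) ^ (∑ x, c x) * w)) := by ring
    _ = _ := by rw [ENNReal.mul_inv_cancel hf0 (ENNReal.natCast_ne_top _), one_mul]

end Splitting

/-! ### The effect of one extra particle on independent Poisson counts. -/

section AddParticle

variable {ι : Type*} [Fintype ι] [DecidableEq ι]

/-- The Mecke identity in one coordinate. Only that coordinate has to be Poisson, so others may be
emptied later. -/
theorem lintegral_pi_poisson_mul (μ : ι → Measure ℕ) [∀ i, IsProbabilityMeasure (μ i)]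
    {i : ι} {r : ℝ≥0} (hi : μ i = poissonMeasure r) (f : (ι → ℕ) → ℝ≥0∞) :
    ∫⁻ c, f c * c i ∂Measure.pi μ = r * ∫⁻ c, f (c + Pi.single i 1) ∂Measure.pi μ := by
  have hs (c : ι → ℕ) : Measure.pi μ {c + Pi.single i 1} * (c i + 1 : ℕ) =
      Measure.pi μ {c} * r := by
    rw [Measure.pi_singleton, Measure.pi_singleton, ← Finset.mul_prod_erase _ _ (Finset.mem_univ i),
      ← Finset.mul_prod_erase _ (fun j => μ j {c j}) (Finset.mem_univ i)]
    have h2 : ∏ j ∈ Finset.univ.erase i, μ j {(c + Pi.single i 1 : ι → ℕ) j} =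
        ∏ j ∈ Finset.univ.erase i, μ j {c j} := by
      refine Finset.prod_congr rfl fun j hj => ?_
      simp [Finset.ne_of_mem_erase hj]
    rw [h2, Pi.add_apply, Pi.single_eq_same, mul_right_comm, hi, poissonMeasure_singleton_succ]
    ring
  have hinj : Function.Injective fun c : ι → ℕ => c + Pi.single i 1 := add_left_injective _
  rw [lintegral_countable', lintegral_countable', ← ENNReal.tsum_mul_left, ← hinj.tsum_eq]
  · refine tsum_congr fun c => ?_
    have := hs c
    simp only [Pi.add_apply, Pi.single_eq_same]
    rw [mul_assoc, mul_comm (_ : ℝ≥0∞) (Measure.pi μ _), this]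
    ring
  · intro c hc
    have hci : c i ≠ 0 := by
      rintro h
      simp [h] at hc
    refine ⟨c - Pi.single i 1, funext fun y => ?_⟩
    by_cases hy : y = i
    · subst hy; simp; omega
    · simp [hy]

/-- Adding one particle at a random place to independent Poisson counts changes their law only a
little if the place is spread out. -/
theorem sum_measure_add_single_le (μ : ι → Measure ℕ) [∀ i, IsProbabilityMeasure (μ i)]
    (q r : ι → ℝ≥0) (hq : ∑ i, q i ≤ 1) (hr : ∀ i, q i ≠ 0 → r i ≠ 0 ∧ μ i = poissonMeasure (r i))
    (s : Set (ι → ℕ)) :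
    ∑ i, (q i : ℝ≥0∞) * Measure.pi μ ((fun c => c + Pi.single i 1) ⁻¹' s) ≤
      Measure.pi μ s + ENNReal.ofReal (Real.sqrt (∑ i, (q i : ℝ) ^ 2 / r i)) := by
  set P := Measure.pi μ
  set Y : (i : ι) → ℕ → ℝ := fun i n => (q i / r i : ℝ) * n with hY
  -- By the Mecke identity, `S` is the density with respect to `P` of the law after adding a
  -- particle. Its mean is Σ q ≤ 1 and its variance Σ q²/r, so S ≤ 1 + |S - E S| and the L¹–L²
  -- inequality give the bound.
  set S : (ι → ℕ) → ℝ := ∑ i, fun c => Y i (c i) with hS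
  have hSa (c : ι → ℕ) : S c = ∑ i, (q i / r i : ℝ) * c i := by simp [hS, hY]
  have hYL (i : ι) : MemLp (Y i) 2 (μ i) := by
    by_cases h : q i = 0
    · simp only [hY, h, NNReal.coe_zero, zero_div, zero_mul]; exact MemLp.zero'
    · rw [(hr i h).2]; exact (memLp_natCast_poissonMeasure _).const_mul _
  have hYv (i : ι) : Var[Y i; μ i] = (q i : ℝ) ^ 2 / r i := by
    by_cases h : q i = 0
    · simp only [hY, h, NNReal.coe_zero, zero_div, zero_mul]
      simp [variance_eq_integral measurable_const.aemeasurable]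
    · have h0 : (r i : ℝ) ≠ 0 := by exact_mod_cast (hr i h).1
      rw [(hr i h).2, hY, variance_const_mul, variance_natCast_poissonMeasure]
      field_simp
  have hYe (i : ι) : ∫ n, Y i n ∂μ i = q i := by
    by_cases h : q i = 0
    · simp [hY, h]
    · have h0 : (r i : ℝ) ≠ 0 := by exact_mod_cast (hr i h).1
      rw [(hr i h).2, hY, integral_const_mul, integral_natCast_poissonMeasure]
      field_simp
  have hYP (i : ι) : MemLp (fun c : ι → ℕ => Y i (c i)) 2 P :=
    (hYL i).comp_measurePreserving (measurePreserving_eval μ i)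
  have hSL : MemLp S 2 P := memLp_finsetSum' _ fun i _ => hYP i
  have hSv : Var[S; P] = ∑ i, (q i : ℝ) ^ 2 / r i := by
    rw [hS, variance_sum_pi hYL]; simp_rw [hYv]
  have hSe : ∫ c, S c ∂P ≤ 1 := by
    have h1 : ∫ c, S c ∂P = ∑ i, (q i : ℝ) := by
      simp only [hS, Finset.sum_apply]
      rw [integral_finsetSum _ fun i _ => (hYP i).integrable (by norm_num)]
      refine Finset.sum_congr rfl fun i _ => ?_
      rw [← hYe i, ← (measurePreserving_eval μ i).map_eq,
        integral_map (measurable_pi_apply i).aemeasurable .of_discrete]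
    rw [h1]; exact_mod_cast hq
  have hdev : ∫⁻ c, ‖S c - ∫ c, S c ∂P‖ₑ ∂P ≤
      ENNReal.ofReal (Real.sqrt (∑ i, (q i : ℝ) ^ 2 / r i)) := by
    rw [← hSv, ← eLpNorm_one_eq_lintegral_enorm]
    refine (eLpNorm_le_eLpNorm_of_exponent_le (q := 2) (by norm_num) .of_discrete).trans ?_
    rw [eLpNorm_eq_lintegral_rpow_enorm_toReal (by simp) (by simp), Real.sqrt_eq_rpow,
      ← ENNReal.ofReal_rpow_of_nonneg (variance_nonneg _ _) (by norm_num), hSL.ofReal_variance_eq,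
      evariance]
    simp
  have hterm (i : ι) : (q i : ℝ≥0∞) * P ((fun c => c + Pi.single i 1) ⁻¹' s) =
      ∫⁻ c, s.indicator 1 c * (ENNReal.ofReal (q i / r i) * c i) ∂P := by
    by_cases h : q i = 0
    · simp [h]
    · have h0 : (r i : ℝ≥0∞) ≠ 0 := by exact_mod_cast (hr i h).1
      simp_rw [← mul_assoc]
      rw [lintegral_pi_poisson_mul μ (hr i h).2, lintegral_mul_const _ .of_discrete,
        ← lintegral_indicator_one .of_discrete]
      have : (q i : ℝ≥0∞) = r i * ENNReal.ofReal (q i / r i) := by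
        rw [ENNReal.ofReal_div_of_pos (by exact_mod_cast pos_iff_ne_zero.2 (hr i h).1)]
        simp only [ENNReal.ofReal_coe_nnreal]
        rw [ENNReal.mul_div_cancel h0 ENNReal.coe_ne_top]
      rw [this, mul_assoc, mul_comm (ENNReal.ofReal _)]
      rfl
  simp_rw [hterm]
  rw [← lintegral_finsetSum _ fun i _ => .of_discrete]
  calc _ ≤ ∫⁻ c, (s.indicator 1 c + ‖S c - ∫ c, S c ∂P‖ₑ) ∂P := by
        refine lintegral_mono fun c => ?_
        rw [← Finset.mul_sum]
        by_cases hc : c ∈ s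
        · simp only [Set.indicator_of_mem hc, Pi.one_apply, one_mul]
          have : ∑ i, ENNReal.ofReal (q i / r i) * (c i : ℝ≥0∞) = ENNReal.ofReal (S c) := by
            rw [hSa, ENNReal.ofReal_sum_of_nonneg fun i _ => by positivity]
            refine Finset.sum_congr rfl fun i _ => ?_
            rw [ENNReal.ofReal_mul (by positivity)]; simp
          rw [this, Real.enorm_eq_ofReal_abs, ← ENNReal.ofReal_one,
            ← ENNReal.ofReal_add zero_le_one (abs_nonneg _)]
          refine ENNReal.ofReal_le_ofReal ?_
          have := le_abs_self (S c - ∫ c, S c ∂P)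
          linarith
        · simp [Set.indicator_of_notMem hc]
    _ ≤ _ := by
        rw [lintegral_add_left .of_discrete, lintegral_indicator_one .of_discrete]
        gcongr

end AddParticle

/-- Extend the weights by 0 off the range of `e`; where the weight is 0 the law of the coordinate is
unrestricted. -/
theorem sum_measure_add_single_le_of_injective {ι J : Type*} [Fintype ι] [DecidableEq ι] [Fintype J]
    (μ : ι → Measure ℕ) [∀ i, IsProbabilityMeasure (μ i)] {e : J → ι} (he : Function.Injective e)
    (q r : J → ℝ≥0) (hq : ∑ j, q j ≤ 1)
    (hr : ∀ j, q j ≠ 0 → r j ≠ 0 ∧ μ (e j) = poissonMeasure (r j)) (s : Set (ι → ℕ)) :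
    ∑ j, (q j : ℝ≥0∞) * Measure.pi μ ((fun c => c + Pi.single (e j) 1) ⁻¹' s) ≤
      Measure.pi μ s + ENNReal.ofReal (Real.sqrt (∑ j, (q j : ℝ) ^ 2 / r j)) := by
  set q' : ι → ℝ≥0 := Function.extend e q 0
  set r' : ι → ℝ≥0 := Function.extend e r 0
  have hq' (j : J) : q' (e j) = q j := he.extend_apply _ _ _
  have hr' (j : J) : r' (e j) = r j := he.extend_apply _ _ _
  have h0 (i : ι) (hi : i ∉ Set.range e) : q' i = 0 := Function.extend_apply' _ _ _ hi
  have h1 : ∑ j, q j = ∑ i, q' i :=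
    Fintype.sum_of_injective e he _ _ h0 fun j => (hq' j).symm
  have h2 : ∑ j, (q j : ℝ) ^ 2 / r j = ∑ i, (q' i : ℝ) ^ 2 / r' i :=
    Fintype.sum_of_injective e he _ _ (fun i hi => by simp [h0 i hi])
      fun j => by rw [hq', hr']
  have h3 : ∑ j, (q j : ℝ≥0∞) * Measure.pi μ ((fun c => c + Pi.single (e j) 1) ⁻¹' s) =
      ∑ i, (q' i : ℝ≥0∞) * Measure.pi μ ((fun c => c + Pi.single i 1) ⁻¹' s) :=
    Fintype.sum_of_injective e he _ _ (fun i hi => by simp [h0 i hi])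
      fun j => by rw [hq']
  rw [h2, h3]
  refine sum_measure_add_single_le μ q' r' (h1 ▸ hq) (fun i hi => ?_) s
  obtain ⟨j, rfl⟩ : i ∈ Set.range e := by
    by_contra h
    exact hi (h0 i h)
  rw [hr']
  exact hr j (by rwa [hq'] at hi)

/-! ### The weights that spread a column particle over larger displacements. -/

section Spread

/-- The spread-out weight on the pairs `j < j'`: from `j`, the index `j'` is uniform above `j`. -/
noncomputable def spreadWeight (k : ℕ) (p : Fin k × Fin k) : ℝ≥0 :=
  if p.1 < p.2 then (k : ℝ≥0)⁻¹ * ((k - 1 - p.1 : ℕ) : ℝ≥0)⁻¹ else 0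

/-- There are k - 1 - j indices above j. The last row is empty, so total mass 1/k is missing. -/
theorem sum_spreadWeight_right {k : ℕ} (j : Fin k) :
    ∑ j', spreadWeight k (j, j') = if (j : ℕ) = k - 1 then 0 else (k : ℝ≥0)⁻¹ := by
  simp only [spreadWeight]
  rw [Finset.sum_ite, Finset.sum_const_zero, add_zero, Finset.sum_const]
  have : (Finset.univ.filter fun j' => j < j') = Finset.Ioi j := by ext; simp
  rw [this, Fin.card_Ioi, nsmul_eq_mul]
  have hj := j.2
  split_ifs with h
  · simp [h]
  · have : ((k - 1 - j : ℕ) : ℝ≥0) ≠ 0 := by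
      rw [Nat.cast_ne_zero]; omega
    field_simp

theorem sum_spreadWeight_le (k : ℕ) [NeZero k] : ∑ p, spreadWeight k p ≤ 1 := by
  have hk : (k : ℝ≥0) ≠ 0 := by exact_mod_cast NeZero.ne k
  rw [Fintype.sum_prod_type]
  simp only [sum_spreadWeight_right]
  calc _ ≤ ∑ _j : Fin k, (k : ℝ≥0)⁻¹ := Finset.sum_le_sum fun j _ => by split_ifs <;> simp
    _ = 1 := by simp [hk]

/-- The mean of `1 / 0 = 0, 1 / 1, …, 1 / (k - 1)`. -/
noncomputable def harmonicMean (k : ℕ) : ℝ := (k : ℝ)⁻¹ * ∑ m ∈ Finset.range k, (m : ℝ)⁻¹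

theorem tendsto_harmonicMean : Filter.Tendsto harmonicMean Filter.atTop (nhds 0) :=
  (tendsto_inv_atTop_nhds_zero_nat (𝕜 := ℝ)).cesaro

/-- In row j a nonzero weight divided by t/k is 1/((k - 1 - j)t), and the row has mass 1/k. The
convention 1/0 = 0 matches the empty last row. -/
theorem sum_spreadWeight_sq (k : ℕ) [NeZero k] (t : ℝ) :
    ∑ p, (spreadWeight k p : ℝ) ^ 2 / (t / k) = harmonicMean k / t := by
  have hk : (k : ℝ) ≠ 0 := by exact_mod_cast NeZero.ne k
  rw [Fintype.sum_prod_type, harmonicMean, ← Finset.sum_range_reflect,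
    Finset.sum_range (n := k), mul_div_assoc, Finset.sum_div, Finset.mul_sum]
  refine Finset.sum_congr rfl fun j _ => ?_
  have hsq (j' : Fin k) : (spreadWeight k (j, j') : ℝ) ^ 2 / (t / k) =
      spreadWeight k (j, j') * (((k - 1 - j : ℕ) : ℝ)⁻¹ / t) := by
    simp only [spreadWeight]
    generalize k - 1 - (j : ℕ) = n
    split_ifs
    · push_cast
      field_simp
    · simp
  simp_rw [hsq]
  rw [← Finset.sum_mul, ← NNReal.coe_sum, sum_spreadWeight_right]
  split_ifs with h
  · simp [h]
  · push_cast; ring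

end Spread

/-! ### The error made by one column particle. -/

section Column

variable {ι Λ : Type*} [Fintype ι] [DecidableEq ι] [Fintype Λ] [MeasurableSpace Λ]

/-- The error in the approximate independence of one white site from the past. -/
noncomputable def columnError (r : ℝ≥0) (lam : Measure Λ) (k : ℕ) : ℝ≥0∞ :=
  (k : ℝ≥0∞)⁻¹ + ∑ l, ENNReal.ofReal (Real.sqrt (harmonicMean k / (r * (lam {l}).toNNReal)))

theorem tendsto_columnError (r : ℝ≥0) (lam : Measure Λ) :
    Filter.Tendsto (columnError r lam) Filter.atTop (nhds 0) := by
  have h1 : Filter.Tendsto (fun k : ℕ => (k : ℝ≥0∞)⁻¹) Filter.atTop (nhds 0) :=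
    ENNReal.tendsto_inv_nat_nhds_zero
  have h2 (l : Λ) : Filter.Tendsto (fun k : ℕ =>
      ENNReal.ofReal (Real.sqrt (harmonicMean k / (r * (lam {l}).toNNReal))))
      Filter.atTop (nhds 0) := by
    have := (tendsto_harmonicMean.div_const ((r : ℝ) * (lam {l}).toNNReal)).sqrt
    simpa using ENNReal.tendsto_ofReal this
  have h3 := h1.add (tendsto_finsetSum Finset.univ fun l _ => h2 l)
  rw [Finset.sum_const_zero, add_zero] at h3
  exact h3

omit [Fintype Λ] in
theorem uniform_prod_singleton (lam : Measure Λ) [IsProbabilityMeasure lam] (k : ℕ) [NeZero k]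
    (m : Fin k × Λ) :
    ((PMF.uniformOfFintype (Fin k)).toMeasure.prod lam) {m} = (k : ℝ≥0∞)⁻¹ * lam {m.2} := by
  rw [← Set.singleton_prod_singleton (a := m.1) (b := m.2), Measure.prod_prod,
    PMF.toMeasure_apply_singleton _ _ (measurableSet_singleton _)]
  simp

/-- Since `s` cannot tell position `d j j` from `d j j'` for j < j', the added particle may be moved
to a random j' above j, where it is absorbed by Poisson counts. Nothing is assumed about the laws on
the diagonal, which will be emptied. -/
theorem sum_add_single_le (ρ : ι → Measure ℕ) [∀ i, IsProbabilityMeasure (ρ i)]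
    (lam : Measure Λ) [IsProbabilityMeasure lam] (k : ℕ) [NeZero k] {r : ℝ≥0} (hr : r ≠ 0)
    {d : Fin k → Fin k → ι} (hd : Function.Injective fun p : Fin k × Fin k => d p.1 p.2)
    {l : Λ} (hl : lam {l} ≠ 0)
    (hρ : ∀ j j', j < j' → ρ (d j j') =
      poissonMeasure (r * (((PMF.uniformOfFintype (Fin k)).toMeasure.prod lam) {(j', l)}).toNNReal))
    (s : Set (ι → ℕ))
    (hs : ∀ j j', j < j' → (fun c : ι → ℕ => c + Pi.single (d j j) 1) ⁻¹' s =
      (fun c : ι → ℕ => c + Pi.single (d j j') 1) ⁻¹' s) :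
    ∑ j, (k : ℝ≥0∞)⁻¹ * Measure.pi ρ ((fun c => c + Pi.single (d j j) 1) ⁻¹' s) ≤
      Measure.pi ρ s + columnError r lam k := by
  have hk : (k : ℝ≥0) ≠ 0 := by exact_mod_cast NeZero.ne k
  have hk0 : k ≠ 0 := NeZero.ne k
  set t : ℝ≥0 := r * (lam {l}).toNNReal with ht
  have htl : (lam {l}).toNNReal ≠ 0 := (ENNReal.toNNReal_ne_zero).2 ⟨hl, measure_ne_top _ _⟩
  have hrate (j' : Fin k) :
      r * (((PMF.uniformOfFintype (Fin k)).toMeasure.prod lam) {(j', l)}).toNNReal = t / k := by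
    rw [uniform_prod_singleton, ENNReal.toNNReal_mul, ENNReal.toNNReal_inv,
      ENNReal.toNNReal_natCast, ht]
    ring
  have h := sum_measure_add_single_le_of_injective ρ hd (spreadWeight k) (fun _ => t / k)
    (sum_spreadWeight_le k) (fun p hp => by
      refine ⟨div_ne_zero (mul_ne_zero hr htl) hk, ?_⟩
      have : p.1 < p.2 := by
        by_contra hlt
        exact hp (if_neg hlt)
      rw [hρ _ _ this, hrate]) s
  have hsum : ∑ p, (spreadWeight k p : ℝ) ^ 2 / ((t / k : ℝ≥0) : ℝ) = harmonicMean k / t := by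
    rw [← sum_spreadWeight_sq]; push_cast; rfl
  rw [hsum, Fintype.sum_prod_type] at h
  -- The last row has no larger index to move to; it is bounded trivially and accounts for the 1/k
  -- in `columnError`.
  have hrow (j : Fin k) :
      (k : ℝ≥0∞)⁻¹ * Measure.pi ρ ((fun c => c + Pi.single (d j j) 1) ⁻¹' s) ≤
      (if (j : ℕ) = k - 1 then (k : ℝ≥0∞)⁻¹ else 0) + ∑ j', (spreadWeight k (j, j') : ℝ≥0∞) *
        Measure.pi ρ ((fun c => c + Pi.single (d j j') 1) ⁻¹' s) := by
    have hsp : ∑ j', (spreadWeight k (j, j') : ℝ≥0∞) *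
        Measure.pi ρ ((fun c => c + Pi.single (d j j') 1) ⁻¹' s) =
        ∑ j', (spreadWeight k (j, j') : ℝ≥0∞) *
        Measure.pi ρ ((fun c => c + Pi.single (d j j) 1) ⁻¹' s) := by
      refine Finset.sum_congr rfl fun j' _ => ?_
      by_cases hlt : j < j'
      · rw [hs j j' hlt]
      · simp [spreadWeight, hlt]
    rw [hsp, ← Finset.sum_mul, ← ENNReal.ofNNReal_finsetSum, sum_spreadWeight_right]
    split_ifs with h
    · calc _ ≤ (k : ℝ≥0∞)⁻¹ * 1 := by gcongr; exact prob_le_one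
        _ ≤ _ := by simp
    · rw [ENNReal.coe_inv hk]; simp
  have hlast : ∑ j : Fin k, (if (j : ℕ) = k - 1 then (k : ℝ≥0∞)⁻¹ else 0) = (k : ℝ≥0∞)⁻¹ := by
    rw [Fin.sum_univ_eq_sum_range fun j => if j = k - 1 then (k : ℝ≥0∞)⁻¹ else 0]
    rw [Finset.sum_ite_eq' (Finset.range k), if_pos (Finset.mem_range.2 (by omega))]
  calc _ ≤ (k : ℝ≥0∞)⁻¹ + (Measure.pi ρ s +
        ENNReal.ofReal (Real.sqrt (harmonicMean k / t))) := by
        refine (Finset.sum_le_sum fun j _ => hrow j).trans ?_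
        rw [Finset.sum_add_distrib, hlast]
        gcongr
    _ ≤ Measure.pi ρ s + columnError r lam k := by
        rw [columnError, add_left_comm]
        gcongr
        have := Finset.single_le_sum (f := fun l =>
          ENNReal.ofReal (Real.sqrt (harmonicMean k / (r * (lam {l}).toNNReal))))
          (fun _ _ => zero_le) (Finset.mem_univ l)
        simpa [ht] using this

end Column

/-! ### Separating a block of coordinates from independent Poisson counts. -/

section Split

variable {ι X G : Type*} [Fintype ι] [DecidableEq ι] [Fintype X] [DecidableEq X]
  [MeasurableSpace X] [DiscreteMeasurableSpace X]
  [AddCommMonoid G] [MeasurableSpace G] [MeasurableAdd₂ G]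

omit [MeasurableSpace G] [MeasurableAdd₂ G] in
/-- A vector of counts is the sum of unit vectors. -/
theorem map_eq_sum_single (Θ : (ι → ℕ) →+ G) (n : ι → ℕ) :
    Θ n = ∑ i, n i • Θ (Pi.single i 1) := by
  conv_lhs => rw [← Finset.univ_sum_single n, map_sum]
  refine Finset.sum_congr rfl fun i _ => ?_
  rw [← map_nsmul]
  congr 1
  ext j
  by_cases h : j = i
  · subst h; simp
  · simp [h]

/-- The additive image of independent Poisson counts, with one block of coordinates written as a
compound Poisson variable. -/
theorem map_pi_poisson_eq_conv (rate : ι → ℝ≥0) {c : X → ι} (hc : Function.Injective c) {r : ℝ≥0}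
    (q : Measure X) [IsProbabilityMeasure q] (hrate : ∀ x, rate (c x) = r * (q {x}).toNNReal)
    (Θ : (ι → ℕ) →+ G) :
    (Measure.pi fun i => poissonMeasure (rate i)).map Θ =
      ((Measure.pi fun i => if i ∈ Finset.univ.image c then Measure.dirac 0
        else poissonMeasure (rate i)).map Θ) ∗
      compoundPoisson r (q.map fun x => Θ (Pi.single (c x) 1)) := by
  set μ := Measure.pi fun i => poissonMeasure (rate i)
  set S : Finset ι := Finset.univ.image c
  have hind : iIndepFun (fun (i : ι) (n : ι → ℕ) => n i) μ :=
    iIndepFun_pi (X := fun _ => id) fun _ => aemeasurable_id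
  have hpair := hind.indepFun_finset Sᶜ S disjoint_compl_left fun i => measurable_pi_apply i
  -- Additivity makes `Θ` the sum of a function of the coordinates off `S` and one of those in `S`;
  -- these are independent.
  set rest : (ι → ℕ) → (ι → ℕ) := fun n i => if i ∈ S then 0 else n i with hrest
  have hrestI : (fun n => Θ (rest n)) =
      (fun v : ((Sᶜ : Finset ι) → ℕ) => Θ fun i => if h : i ∈ Sᶜ then v ⟨i, h⟩ else 0) ∘
        fun n i => n i := by
    funext n
    simp only [Function.comp]
    congr 1
    funext i
    by_cases h : i ∈ S <;> simp [hrest, h]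
  have hcolI : (fun n : ι → ℕ => ∑ x, n (c x) • Θ (Pi.single (c x) 1)) =
      (fun v : (S → ℕ) => ∑ x, v ⟨c x, Finset.mem_image_of_mem c (Finset.mem_univ x)⟩ •
        Θ (Pi.single (c x) 1)) ∘ fun n i => n i := rfl
  have hI : IndepFun (fun n => Θ (rest n))
      (fun n : ι → ℕ => ∑ x, n (c x) • Θ (Pi.single (c x) 1)) μ := by
    rw [hrestI, hcolI]
    exact hpair.comp .of_discrete .of_discrete
  have hsum : (Θ : (ι → ℕ) → G) = (fun n => Θ (rest n)) +
      fun n : ι → ℕ => ∑ x, n (c x) • Θ (Pi.single (c x) 1) := by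
    funext n
    rw [Pi.add_apply, map_eq_sum_single Θ n, map_eq_sum_single Θ (rest n),
      ← Finset.sum_add_sum_compl S (fun i => n i • Θ (Pi.single i 1)),
      ← Finset.sum_add_sum_compl S (fun i => rest n i • Θ (Pi.single i 1)), add_comm]
    have h1 : ∑ i ∈ S, rest n i • Θ (Pi.single i 1) = 0 :=
      Finset.sum_eq_zero fun i hi => by simp [hrest, hi]
    have h2 : ∑ i ∈ Sᶜ, rest n i • Θ (Pi.single i 1) = ∑ i ∈ Sᶜ, n i • Θ (Pi.single i 1) :=
      Finset.sum_congr rfl fun i hi => by simp [hrest, Finset.mem_compl.1 hi]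
    rw [h1, h2, zero_add, Finset.sum_image hc.injOn]
  have hrestL : μ.map rest = Measure.pi fun i => if i ∈ S then Measure.dirac 0
      else poissonMeasure (rate i) := by
    have h := Measure.pi_map_pi (μ := fun i => poissonMeasure (rate i))
      (f := fun i (n : ℕ) => if i ∈ S then 0 else n)
      (hμ := fun i => by
        have : IsProbabilityMeasure ((poissonMeasure (rate i)).map fun n => if i ∈ S then 0 else n) :=
          Measure.isProbabilityMeasure_map .of_discrete
        infer_instance) fun i => .of_discrete
    rw [show rest = fun n i => if i ∈ S then 0 else n i from rfl, h]
    congr 1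
    funext i
    by_cases hi : i ∈ S
    · simp only [hi, if_true]; simp
    · simp only [hi, if_false]; exact Measure.map_id
  have hcolL : μ.map (fun n x => n (c x)) = Measure.pi fun x => poissonMeasure (rate (c x)) := by
    have h := (hind.precomp hc).map_fun_eq_pi_map fun x => (measurable_pi_apply _).aemeasurable
    refine h.trans ?_
    congr 1
    funext x
    exact (measurePreserving_eval (fun i => poissonMeasure (rate i)) (c x)).map_eq
  set E : (X → ℕ) →+ G :=
    { toFun := fun v => ∑ x, v x • Θ (Pi.single (c x) 1)
      map_zero' := by simp
      map_add' := fun v w => by simp [add_smul, Finset.sum_add_distrib] } with hE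
  have hqs : Measurable fun x : X => (Pi.single x 1 : X → ℕ) := .of_discrete
  have : IsProbabilityMeasure (q.map fun x => (Pi.single x 1 : X → ℕ)) :=
    Measure.isProbabilityMeasure_map hqs.aemeasurable
  conv_lhs => rw [hsum]
  rw [hI.map_add_eq_map_conv_map .of_discrete .of_discrete, ← hrestL,
    Measure.map_map .of_discrete .of_discrete]
  congr 1
  have h1 : μ.map (fun n : ι → ℕ => ∑ x, n (c x) • Θ (Pi.single (c x) 1)) =
      (μ.map (fun n x => n (c x))).map E := by
    rw [Measure.map_map .of_discrete .of_discrete]; rfl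
  rw [h1, hcolL]
  simp_rw [hrate]
  -- Splitting read backwards: the block is a Poisson number of particles with independent marks of
  -- law `q`.
  rw [← compoundPoisson_single, compoundPoisson_map r _ E .of_discrete,
    Measure.map_map .of_discrete hqs]
  congr 2
  funext x
  simp [hE, Pi.single_apply]

end Split

/-! ### Near independence of a column and the past. -/

section Column

variable {ι Λ G G' : Type*} [Fintype ι] [DecidableEq ι] [Fintype Λ] [DecidableEq Λ]
  [MeasurableSpace Λ] [DiscreteMeasurableSpace Λ]
  [AddCommMonoid G] [MeasurableSpace G] [Countable G] [DiscreteMeasurableSpace G]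
  [AddCommMonoid G'] [MeasurableSpace G'] [Countable G'] [DiscreteMeasurableSpace G']

/-- Independent Poisson counts contain a block `d j j l` of entries that determines `Ψ`. If `Φ`
does not distinguish a particle in this block from one at `d j j' l`, `j < j'`, then `Φ` and `Ψ` are
nearly independent. -/
theorem close_map_prod (rate : ι → ℝ≥0) (lam : Measure Λ) [IsProbabilityMeasure lam]
    (k : ℕ) [NeZero k] {r : ℝ≥0} (hr : r ≠ 0) {d : Fin k → Fin k → Λ → ι}
    (hd : Function.Injective fun p : Fin k × Fin k × Λ => d p.1 p.2.1 p.2.2)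
    (hrate : ∀ j j' l, rate (d j j' l) =
      r * (((PMF.uniformOfFintype (Fin k)).toMeasure.prod lam) {(j', l)}).toNNReal)
    (Φ : (ι → ℕ) →+ G) (Ψ : (ι → ℕ) →+ G') (w : Λ → G')
    (hΦ : ∀ j j' l, j < j' → Φ (Pi.single (d j j' l) 1) = Φ (Pi.single (d j j l) 1))
    (hΨ : ∀ j l, Ψ (Pi.single (d j j l) 1) = w l)
    (hΨ0 : ∀ i, (∀ j l, i ≠ d j j l) → Ψ (Pi.single i 1) = 0) :
    Close (2 * (r * columnError r lam k))
      ((Measure.pi fun i => poissonMeasure (rate i)).map fun n => (Φ n, Ψ n))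
      (((Measure.pi fun i => poissonMeasure (rate i)).map Φ).prod
        (compoundPoisson r (lam.map w))) := by
  have : MeasurableAdd₂ G := ⟨.of_discrete⟩
  have : MeasurableAdd₂ G' := ⟨.of_discrete⟩
  have : MeasurableAdd₂ (G × G') := ⟨.of_discrete⟩
  set q : Measure (Fin k × Λ) := (PMF.uniformOfFintype (Fin k)).toMeasure.prod lam with hq
  set c : Fin k × Λ → ι := fun x => d x.1 x.1 x.2
  have hc : Function.Injective c := fun x y h => by
    have := @hd (x.1, x.1, x.2) (y.1, y.1, y.2) h
    simp only [Prod.mk.injEq] at this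
    exact Prod.ext this.1 this.2.2
  have hcm (i : ι) : i ∈ Finset.univ.image c ↔ ∃ j l, i = d j j l := by
    simp [c, eq_comm]
  set ρ : ι → Measure ℕ := fun i => if i ∈ Finset.univ.image c then Measure.dirac 0
    else poissonMeasure (rate i) with hρ
  have hρp (i : ι) : IsProbabilityMeasure (ρ i) := by
    simp only [hρ]; split_ifs <;> infer_instance
  set Θ : (ι → ℕ) →+ G × G' := Φ.prod Ψ with hΘ
  -- `κ` is the effect of one column particle on (`Φ`, `Ψ`), and `κ'` below is the same effect with
  -- the `Φ` part erased. `U` is the law of (`Φ`, `Ψ`) with the column emptied.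
  set κ : Measure (G × G') := q.map fun x => Θ (Pi.single (c x) 1) with hκ
  have hwm : Measurable w := .of_discrete
  have hκp : IsProbabilityMeasure κ := Measure.isProbabilityMeasure_map .of_discrete
  have hwp : IsProbabilityMeasure (lam.map w) := Measure.isProbabilityMeasure_map hwm.aemeasurable
  set κ' : Measure (G × G') := (lam.map w).map (AddMonoidHom.inr G G') with hκ'
  have hκp' : IsProbabilityMeasure κ' := Measure.isProbabilityMeasure_map .of_discrete
  set U : Measure (G × G') := (Measure.pi ρ).map Θ with hU
  have hUp : IsProbabilityMeasure U := Measure.isProbabilityMeasure_map .of_discrete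
  set R : Measure G := (Measure.pi ρ).map Φ with hR
  have hRp : IsProbabilityMeasure R := Measure.isProbabilityMeasure_map .of_discrete
  have hΨρ : ∀ᵐ n ∂Measure.pi ρ, Ψ n = 0 := by
    have h1 : ∀ i ∈ Finset.univ.image c, ∀ᵐ n ∂Measure.pi ρ, n i = 0 := fun i hi => by
      have h2 : ∀ᵐ m ∂ρ i, m = 0 := by
        simp only [hρ, hi, if_true]
        rw [ae_dirac_iff .of_discrete]
      rw [← (measurePreserving_eval ρ i).map_eq, ae_map_iff .of_discrete .of_discrete] at h2
      exact h2
    have h3 : ∀ᵐ n ∂Measure.pi ρ, ∀ i, i ∈ Finset.univ.image c → n i = 0 :=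
      ae_all_iff.2 fun i => by
        by_cases hi : i ∈ Finset.univ.image c
        · exact (h1 i hi).mono fun n hn _ => hn
        · exact .of_forall fun n h => absurd h hi
    refine h3.mono fun n hn => ?_
    rw [map_eq_sum_single Ψ n]
    refine Finset.sum_eq_zero fun i _ => ?_
    by_cases hi : i ∈ Finset.univ.image c
    · rw [hn i hi, zero_smul]
    · rw [hΨ0 i fun j l h => hi ((hcm i).2 ⟨j, l, h⟩), smul_zero]
  have hUR : U = R.map (AddMonoidHom.inl G G') := by
    rw [hU, hR, Measure.map_map .of_discrete .of_discrete]
    refine Measure.map_congr (hΨρ.mono fun n hn => ?_)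
    simp [hΘ, hn]
  have hlaw : (Measure.pi fun i => poissonMeasure (rate i)).map (fun n => (Φ n, Ψ n)) =
      U ∗ compoundPoisson r κ :=
    map_pi_poisson_eq_conv rate hc q (fun x => hrate _ _ _) Θ
  have hprod : U ∗ compoundPoisson r κ' = R.prod (compoundPoisson r (lam.map w)) := by
    rw [hκ', ← compoundPoisson_map r _ _ .of_discrete, hUR, Measure.conv,
      Measure.map_prod_map _ _ .of_discrete .of_discrete, Measure.map_map .of_discrete .of_discrete]
    have : (fun x : (G × G') × (G × G') => x.1 + x.2) ∘
        Prod.map (AddMonoidHom.inl G G') (AddMonoidHom.inr G G') = id := by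
      ext x <;> simp
    rw [this, Measure.map_id]
  have hmain : Close (columnError r lam k) (U ∗ κ) (U ∗ κ') := by
    intro s _
    -- With the column emptied `Ψ` vanishes almost surely, so after adding a particle of label l it
    -- equals `w l`. The event then concerns `Φ` alone, which does not distinguish `d j j l` from `d
    -- j j' l`.
    set sl : Λ → Set (ι → ℕ) := fun l => {n | (Φ n, w l) ∈ s}
    have hL : (U ∗ κ) s = ∑ l, lam {l} * ∑ j, (k : ℝ≥0∞)⁻¹ *
        Measure.pi ρ ((fun n => n + Pi.single (d j j l) 1) ⁻¹' sl l) := by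
      rw [Measure.conv_comm, Measure.conv, Measure.map_apply measurable_add .of_discrete,
        Measure.prod_apply .of_discrete, hκ, lintegral_map .of_discrete .of_discrete,
        lintegral_fintype, Fintype.sum_prod_type_right]
      refine Finset.sum_congr rfl fun l _ => ?_
      rw [Finset.mul_sum]
      refine Finset.sum_congr rfl fun j _ => ?_
      rw [hq, uniform_prod_singleton, hU, Measure.map_apply .of_discrete .of_discrete]
      have hae : (Θ ⁻¹' (Prod.mk (Θ (Pi.single (c (j, l)) 1)) ⁻¹'
          ((fun p : (G × G') × (G × G') => p.1 + p.2) ⁻¹' s)) : Set (ι → ℕ)) =ᵐ[Measure.pi ρ]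
          ((fun n => n + Pi.single (d j j l) 1) ⁻¹' sl l : Set (ι → ℕ)) := by
        refine Filter.eventuallyEq_set.2 (hΨρ.mono fun n hn => ?_)
        simp [hΘ, sl, c, hn, hΨ, add_comm]
      rw [measure_congr hae]
      ring
    have hR' : (U ∗ κ') s = ∑ l, lam {l} * Measure.pi ρ (sl l) := by
      rw [Measure.conv_comm, Measure.conv, Measure.map_apply measurable_add .of_discrete,
        Measure.prod_apply .of_discrete, hκ', lintegral_map .of_discrete .of_discrete,
        lintegral_map .of_discrete hwm, lintegral_fintype]
      refine Finset.sum_congr rfl fun l _ => ?_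
      rw [hUR, hR, Measure.map_map .of_discrete .of_discrete,
        Measure.map_apply .of_discrete .of_discrete, mul_comm]
      congr 2
      ext n
      simp [sl]
    have hlam : ∑ l, lam {l} = 1 := by
      rw [← measure_univ (μ := lam), ← Finset.coe_univ, ← sum_measure_singleton]
    rw [hL, hR', ← one_mul (columnError r lam k), ← hlam, Finset.sum_mul, ← Finset.sum_add_distrib]
    refine Finset.sum_le_sum fun l _ => ?_
    rw [← mul_add]
    rcases eq_or_ne (lam {l}) 0 with hl | hl
    · simp [hl]
    · gcongr
      refine sum_add_single_le (d := fun j j' => d j j' l) ρ lam k hr ?_ hl ?_ _ ?_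
      · intro x y h
        have := @hd (x.1, x.2, l) (y.1, y.2, l) h
        simp only [Prod.mk.injEq, and_true] at this
        exact Prod.ext this.1 this.2
      · intro j j' hj
        have : d j j' l ∉ Finset.univ.image c := fun h => by
          obtain ⟨j₁, l₁, h⟩ := (hcm _).1 h
          have := @hd (j, j', l) (j₁, j₁, l₁) h
          simp only [Prod.mk.injEq] at this
          omega
        simp only [hρ, this, if_false]
        rw [hrate]
      · intro j j' hj
        ext n
        simp [sl, hΦ j j' l hj]
  have h1 := close_conv_compoundPoisson r hmain
  rw [← hlaw, hprod] at h1
  set P := (Measure.pi fun i => poissonMeasure (rate i)).map fun n => (Φ n, Ψ n) with hP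
  have hPp : IsProbabilityMeasure P := Measure.isProbabilityMeasure_map .of_discrete
  have h2 := h1.map measurable_fst
  rw [Measure.map_fst_prod, measure_univ, one_smul] at h2
  have hfst : P.map Prod.fst = (Measure.pi fun i => poissonMeasure (rate i)).map Φ :=
    Measure.map_map measurable_fst .of_discrete
  rw [hfst] at h2
  have hΦp : IsProbabilityMeasure ((Measure.pi fun i => poissonMeasure (rate i)).map Φ) :=
    Measure.isProbabilityMeasure_map .of_discrete
  -- The first error erases the effect of the column on `Φ`; the second replaces `R`, the law of `Φ`
  -- without the column, by its true law. The latter comparison is the first one projected to `Φ`,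
  -- hence the factor 2.
  rw [two_mul]
  exact h1.trans (h2.symm.prod_right _)

end Column

/-! ### Label counts as sums of unit vectors. -/

section LabelCount

theorem labelCount_apply {X : Type*} [DecidableEq X] (n : ℕ) (l : ℕ → X) (a : X) :
    labelCount n l a = ∑ i ∈ Finset.range n, if l i = a then 1 else 0 := by
  rw [labelCount, Finset.card_filter]
  refine Finset.sum_congr rfl fun i _ => ?_
  by_cases h : l i = a <;> simp [h]

theorem labelCount_eq_sum {X : Type*} [DecidableEq X] (n : ℕ) (l : ℕ → X) :
    labelCount n l = ∑ i ∈ Finset.range n, (Pi.single (l i) 1 : X → ℕ) := by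
  funext a
  rw [labelCount_apply, Finset.sum_apply]
  refine Finset.sum_congr rfl fun i _ => ?_
  by_cases h : l i = a
  · subst h; simp
  · rw [if_neg h, Pi.single_eq_of_ne (Ne.symm h)]

theorem measurable_sum_range {X G : Type*} [MeasurableSpace X] [AddCommMonoid G]
    [MeasurableSpace G] [MeasurableAdd₂ G] {f : X → G} (hf : Measurable f) :
    Measurable fun p : ℕ × (ℕ → X) => ∑ i ∈ Finset.range p.1, f (p.2 i) :=
  measurable_from_prod_countable_right fun n => by
    simp only
    exact Finset.measurable_sum _ fun i _ => hf.comp (measurable_pi_apply i)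

variable {X : Type*} [DecidableEq X] [MeasurableSpace X] [DiscreteMeasurableSpace X]

theorem measurable_labelCount :
    Measurable fun p : ℕ × (ℕ → X) => labelCount p.1 p.2 := by
  simp_rw [labelCount_eq_sum]
  exact measurable_sum_range (f := fun x : X => (Pi.single x 1 : X → ℕ)) .of_discrete

theorem map_labelCount (r : ℝ≥0) (m : Measure X) [IsProbabilityMeasure m] :
    ((poissonMeasure r).prod (Measure.infinitePi fun _ : ℕ => m)).map
      (fun p => labelCount p.1 p.2) =
      compoundPoisson r (m.map fun x => (Pi.single x 1 : X → ℕ)) := by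
  simp_rw [labelCount_eq_sum]
  exact map_sum_poisson_prod r m (f := fun x : X => (Pi.single x 1 : X → ℕ)) .of_discrete

end LabelCount

/-! ### From couplings of white words to `dBarBlock`. -/

section Zip

/-- The word of pairs made from two words. -/
def zipBlock {L : ℕ} {S T : Type*} (p : (Fin L → S) × (Fin L → T)) (i : Fin L) : S × T :=
  (p.1 i, p.2 i)

theorem map_zipBlock_prod_pi {L : ℕ} {S T : Type*} [MeasurableSpace S] [MeasurableSpace T]
    [Countable S] [Countable T] [DiscreteMeasurableSpace S] [DiscreteMeasurableSpace T]
    (P : Measure S) (Q : Measure T) [IsProbabilityMeasure P] [IsProbabilityMeasure Q] :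
    ((Measure.pi fun _ : Fin L => P).prod (Measure.pi fun _ : Fin L => Q)).map zipBlock =
      Measure.pi fun _ : Fin L => P.prod Q := by
  refine Measure.ext_iff_singleton.2 fun c => ?_
  have hpre : (zipBlock ⁻¹' {c} : Set ((Fin L → S) × (Fin L → T))) =
      {fun i => (c i).1} ×ˢ {fun i => (c i).2} := by
    ext ⟨b, w⟩
    simp only [Set.mem_preimage, Set.mem_singleton_iff, Set.mem_prod, funext_iff, zipBlock,
      Prod.ext_iff, forall_and]
  rw [Measure.map_apply .of_discrete .of_discrete, hpre, Measure.prod_prod, Measure.pi_singleton,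
    Measure.pi_singleton, Measure.pi_singleton, ← Finset.prod_mul_distrib]
  refine Finset.prod_congr rfl fun i _ => ?_
  rw [← Measure.prod_prod, Set.singleton_prod_singleton]

open Classical in
theorem hammingDist_zipBlock_le {L : ℕ} {S T : Type*} (b : Fin L → S) (w w' : Fin L → T) :
    hammingDist (zipBlock (b, w)) (zipBlock (b, w')) ≤ hammingDist w w' := by
  refine Finset.card_le_card fun i hi => ?_
  simpa [zipBlock] using hi

/-- A joining of `(b, w)` and `(b, w')` with few differences bounds `dBarBlock`. -/
theorem dBarBlock_le_of_sequence {S T Ω : Type*} [MeasurableSpace S] [MeasurableSpace T]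
    [MeasurableSpace Ω] [Countable S] [Countable T] [DiscreteMeasurableSpace S]
    [DiscreteMeasurableSpace T] {μ' ν' : Measure (ℤ → S × T)} {L : ℕ} (hL : 1 ≤ L)
    (μ : Measure Ω) [IsProbabilityMeasure μ] {B : Ω → Fin L → S} (hB : Measurable B)
    {W : ℕ → Ω → T} (hW : ∀ i, Measurable (W i)) (ν : Measure T) [IsProbabilityMeasure ν]
    (τ : ℝ≥0∞)
    (h : ∀ i < L, Close τ (μ.map fun ω => ((B ω, fun j : Fin i => W j ω), W i ω))
      ((μ.map fun ω => (B ω, fun j : Fin i => W j ω)).prod ν))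
    (hμ' : blockLaw μ' L = ((μ.map B).prod (Measure.pi fun _ : Fin L => ν)).map zipBlock)
    (hν' : blockLaw ν' L = (μ.map fun ω => (B ω, fun j : Fin L => W j ω)).map zipBlock) :
    dBarBlock μ' ν' L ≤ τ := by
  classical
  obtain ⟨π, hπ, hπB, hπd⟩ := exists_isJoining_sequence μ hB hW ν τ L h
  have := hπ.isProbabilityMeasure
  set F : ((Fin L → S) × (Fin L → T)) × ((Fin L → S) × (Fin L → T)) →
      (Fin L → S × T) × (Fin L → S × T) := fun p => (zipBlock p.2, zipBlock p.1)
  have hF : Measurable F := .of_discrete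
  have hz : Measurable (zipBlock : (Fin L → S) × (Fin L → T) → Fin L → S × T) := .of_discrete
  have hJ : IsJoining (π.map F) (blockLaw μ' L) (blockLaw ν' L) := by
    refine ⟨Measure.isProbabilityMeasure_map hF.aemeasurable, ?_, ?_⟩
    · rw [Measure.map_map measurable_fst hF, hμ', ← hπ.map_snd, Measure.map_map hz measurable_snd]
      rfl
    · rw [Measure.map_map measurable_snd hF, hν', ← hπ.map_fst, Measure.map_map hz measurable_fst]
      rfl
  refine (iInf₂_le (π.map F) hJ).trans ?_
  rw [lintegral_map .of_discrete hF]
  have hL0 : (L : ℝ≥0∞) ≠ 0 := by simp; omega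
  calc _ ≤ ∫⁻ p, (hammingDist p.1.2 p.2.2 : ℝ≥0∞) * (L : ℝ≥0∞)⁻¹ ∂π := by
        refine lintegral_mono_ae (hπB.mono fun p hp => ?_)
        rw [normalizedHamming, div_eq_mul_inv]
        gcongr
        have h1 := hammingDist_zipBlock_le p.1.1 p.2.2 p.1.2
        rw [hammingDist_comm p.2.2] at h1
        have h2 : p.2 = (p.1.1, p.2.2) := Prod.ext hp.symm rfl
        refine le_trans (le_of_eq ?_) h1
        simp only [F]
        rw [← h2]
        congr!
    _ ≤ L * τ * (L : ℝ≥0∞)⁻¹ := by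
        rw [lintegral_mul_const _ .of_discrete]
        gcongr
    _ = τ := by
        rw [mul_comm, ← mul_assoc, ENNReal.inv_mul_cancel hL0 (ENNReal.natCast_ne_top _), one_mul]

end Zip

/-! ### Block laws of the free process. -/

section Xi

variable {A : Type*} [Fintype A] [DecidableEq A] [MeasurableSpace A] [DiscreteMeasurableSpace A]

/-- The law of the label counts of a Poisson number of particles with independent labels. -/
noncomputable def siteLaw (r : ℝ≥0) (m : Measure A) : Measure (A → ℕ) :=
  compoundPoisson r (m.map fun a => Pi.single a 1)

instance (r : ℝ≥0) (m : Measure A) [IsProbabilityMeasure m] :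
    IsProbabilityMeasure (siteLaw r m) := by
  have : IsProbabilityMeasure (m.map fun a => (Pi.single a 1 : A → ℕ)) :=
    Measure.isProbabilityMeasure_map .of_discrete
  unfold siteLaw
  infer_instance

theorem map_infinitePi_block {Y S : Type*} [MeasurableSpace Y] [MeasurableSpace S]
    (P : Measure Y) [IsProbabilityMeasure P] {f : Y → S} (hf : Measurable f) (L : ℕ) :
    (Measure.infinitePi fun _ : ℤ => P).map (fun ω (i : Fin L) => f (ω ((i : ℤ) + 1))) =
      Measure.pi fun _ : Fin L => P.map f := by
  have hind : iIndepFun (fun (x : ℤ) (ω : ℤ → Y) => f (ω x)) (Measure.infinitePi fun _ : ℤ => P) :=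
    iIndepFun_infinitePi (X := fun _ => f) fun _ => hf
  have hinj : Function.Injective fun i : Fin L => (i : ℤ) + 1 := fun i j h => by
    ext; simpa using h
  refine ((hind.precomp hinj).map_fun_eq_pi_map fun i =>
    (hf.comp (measurable_pi_apply _)).aemeasurable).trans ?_
  congr 1
  funext i
  conv_rhs => rw [← Measure.infinitePi_map_eval (fun _ : ℤ => P) ((i : ℤ) + 1)]
  rw [Measure.map_map hf (by fun_prop)]

theorem blockLaw_xiLaw (δ : ℝ≥0) (PB PW : Measure A) [IsProbabilityMeasure PB]
    [IsProbabilityMeasure PW] (L : ℕ) :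
    blockLaw (xiLaw δ PB PW) L =
      ((Measure.pi fun _ : Fin L => siteLaw (δ / 2) PB).prod
        (Measure.pi fun _ : Fin L => siteLaw (δ / 2) PW)).map zipBlock := by
  have hf : Measurable fun y : (ℕ × (ℕ → A)) × (ℕ × (ℕ → A)) =>
      ((labelCount y.1.1 y.1.2, labelCount y.2.1 y.2.2) : SiteCounts A) :=
    (measurable_labelCount.comp measurable_fst).prodMk (measurable_labelCount.comp measurable_snd)
  have hfree : Measurable (freeCounts : FreeConfig A → ℤ → SiteCounts A) :=
    measurable_pi_lambda _ fun x => hf.comp (measurable_pi_apply x)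
  rw [map_zipBlock_prod_pi, blockLaw, xiLaw, Measure.map_map (by fun_prop) hfree]
  refine (map_infinitePi_block _ hf L).trans ?_
  congr 1
  funext _
  rw [siteLaw, siteLaw, ← map_labelCount, ← map_labelCount,
    Measure.map_prod_map _ _ measurable_labelCount measurable_labelCount]
  rfl

end Xi

/-! ### The linked process: independent Poisson marks, and the white counts given the past. -/

section Zeta

variable {A : Type*} [Fintype A] [DecidableEq A] {k : ℕ}

/-- The numbers of black particles at `x` by displacement index and pair of labels. -/
noncomputable def linkedMarks (ω : LinkedConfig A k) (x : ℤ) : Fin k × (A × A) → ℕ :=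
  labelCount (ω x).1 (ω x).2

theorem linkedBlackCount_eq (ω : LinkedConfig A k) (x : ℤ) :
    linkedBlackCount ω x = ∑ m, linkedMarks ω x m • (Pi.single m.2.1 1 : A → ℕ) := by
  funext a
  simp only [linkedBlackCount, Finset.card_filter, linkedMarks, labelCount_apply, Finset.sum_apply,
    Pi.smul_apply, smul_eq_mul, Finset.sum_mul]
  rw [Finset.sum_comm]
  refine Finset.sum_congr rfl fun i _ => ?_
  rw [Finset.sum_eq_single ((ω x).2 i) (fun m _ hm => by simp [hm.symm]) (by simp)]
  simp [Pi.single_apply, eq_comm]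

theorem linkedWhiteCount_eq (M : ℤ) (ω : LinkedConfig A k) (x : ℤ) :
    linkedWhiteCount M ω x =
      ∑ m, linkedMarks ω (x - (M + (m.1 : ℤ))) m • (Pi.single m.2.2 1 : A → ℕ) := by
  funext b
  simp only [linkedWhiteCount, Finset.card_filter, linkedMarks, labelCount_apply, Finset.sum_apply,
    Pi.smul_apply, smul_eq_mul, Finset.sum_mul]
  rw [Fintype.sum_prod_type]
  refine Finset.sum_congr rfl fun j _ => ?_
  dsimp only
  rw [Finset.sum_comm]
  refine Finset.sum_congr rfl fun i _ => ?_
  by_cases h : ((ω (x - (M + (j : ℤ)))).2 i).1 = j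
  · rw [Finset.sum_eq_single ((ω (x - (M + (j : ℤ)))).2 i).2
      (fun ab _ hab => by simp [Prod.ext_iff, h, Prod.ext_iff.not.1 hab.symm])
      (by simp)]
    simp [Prod.ext_iff, h, Pi.single_apply, eq_comm]
  · simp [Prod.ext_iff, h]

variable [MeasurableSpace A] [DiscreteMeasurableSpace A]

theorem measurable_linkedMarks (x : ℤ) :
    Measurable fun ω : LinkedConfig A k => linkedMarks ω x :=
  measurable_labelCount.comp (measurable_pi_apply x)

theorem measurable_linkedBlackCount (x : ℤ) :
    Measurable fun ω : LinkedConfig A k => linkedBlackCount ω x := by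
  simp_rw [linkedBlackCount_eq]
  have h : Measurable fun n : Fin k × (A × A) → ℕ =>
    ∑ m, n m • (Pi.single m.2.1 1 : A → ℕ) := .of_discrete
  exact h.comp (measurable_linkedMarks x)

theorem measurable_linkedWhiteCount (M : ℤ) (x : ℤ) :
    Measurable fun ω : LinkedConfig A k => linkedWhiteCount M ω x := by
  simp_rw [linkedWhiteCount_eq]
  refine Finset.measurable_sum _ fun m _ => ?_
  have h : Measurable fun n : Fin k × (A × A) → ℕ => n m • (Pi.single m.2.2 1 : A → ℕ) :=
    .of_discrete
  exact h.comp (measurable_linkedMarks _)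

variable (lam : Measure (A × A)) [IsProbabilityMeasure lam] [NeZero k]

instance (δ : ℝ≥0) : IsProbabilityMeasure (linkedMeasure δ lam k) := by
  unfold linkedMeasure; infer_instance

/-- The marks at finitely many sites are independent Poisson variables. -/
theorem map_linkedMarks (δ : ℝ≥0) {ι : Type*} [Fintype ι] {e : ι → ℤ × (Fin k × (A × A))}
    (he : Function.Injective e) :
    (linkedMeasure δ lam k).map (fun ω i => linkedMarks ω (e i).1 (e i).2) =
      Measure.pi fun i => poissonMeasure (δ / 2 *
        (((PMF.uniformOfFintype (Fin k)).toMeasure.prod lam) {(e i).2}).toNNReal) := by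
  have hlaw (x : ℤ) : (linkedMeasure δ lam k).map (fun ω => linkedMarks ω x) =
      Measure.pi fun m => poissonMeasure (δ / 2 *
        (((PMF.uniformOfFintype (Fin k)).toMeasure.prod lam) {m}).toNNReal) := by
    rw [← compoundPoisson_single, ← map_labelCount,
      ← Measure.infinitePi_map_eval (fun _ : ℤ => (poissonMeasure (δ / 2)).prod
        (Measure.infinitePi fun _ : ℕ => (PMF.uniformOfFintype (Fin k)).toMeasure.prod lam)) x,
      Measure.map_map measurable_labelCount (by fun_prop)]
    rfl
  have hm (x : ℤ) (m : Fin k × (A × A)) :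
      Measurable fun ω : LinkedConfig A k => linkedMarks ω x m :=
    (measurable_pi_apply m).comp (measurable_linkedMarks x)
  have hlaw1 (x : ℤ) (m : Fin k × (A × A)) :
      (linkedMeasure δ lam k).map (fun ω => linkedMarks ω x m) = poissonMeasure (δ / 2 *
        (((PMF.uniformOfFintype (Fin k)).toMeasure.prod lam) {m}).toNNReal) := by
    rw [← (measurePreserving_eval (fun m => poissonMeasure (δ / 2 *
      (((PMF.uniformOfFintype (Fin k)).toMeasure.prod lam) {m}).toNNReal)) m).map_eq, ← hlaw x,
      Measure.map_map (by fun_prop) (measurable_linkedMarks x)]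
    rfl
  have hind : iIndepFun (fun (p : ℤ × (Fin k × (A × A))) (ω : LinkedConfig A k) =>
      linkedMarks ω p.1 p.2) (linkedMeasure δ lam k) := by
    refine iIndepFun_uncurry' (X := fun x m ω => linkedMarks ω x m) hm ?_ fun x => ?_
    · exact iIndepFun_infinitePi
        (X := fun (_ : ℤ) (y : ℕ × (ℕ → Fin k × (A × A))) => labelCount y.1 y.2)
        fun _ => measurable_labelCount
    · rw [iIndepFun_iff_map_fun_eq_pi_map fun m => (hm x m).aemeasurable]
      simp_rw [hlaw1]
      exact hlaw x
  refine ((hind.precomp he).map_fun_eq_pi_map fun i => (hm _ _).aemeasurable).trans ?_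
  congr 1
  funext i
  exact hlaw1 _ _

/-- The additive map that sends the `i`-th unit vector to `v i`. -/
def weightedSum {ι G : Type*} [Fintype ι] [AddCommMonoid G] (v : ι → G) : (ι → ℕ) →+ G where
  toFun n := ∑ i, n i • v i
  map_zero' := by simp
  map_add' n n' := by simp [add_smul, Finset.sum_add_distrib]

theorem weightedSum_apply {ι G : Type*} [Fintype ι] [AddCommMonoid G] (v : ι → G) (n : ι → ℕ) :
    weightedSum v n = ∑ i, n i • v i := rfl

theorem weightedSum_single {ι G : Type*} [Fintype ι] [DecidableEq ι] [AddCommMonoid G] (v : ι → G)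
    (i : ι) : weightedSum v (Pi.single i 1) = v i := by
  simp [weightedSum_apply, Pi.single_apply]

/-- The white counts at a site are nearly independent of all black counts and of the white counts
at the earlier sites. -/
theorem close_linkedCounts (δ : ℝ≥0) (hδ : δ ≠ 0) (M : ℤ) {L i : ℕ} (hi : i < L) :
    Close (2 * ((δ / 2 : ℝ≥0) * columnError (δ / 2) lam k))
      ((linkedMeasure δ lam k).map fun ω =>
        ((fun j : Fin L => linkedBlackCount ω ((j : ℤ) + 1),
          fun j : Fin i => linkedWhiteCount M ω (((j : ℕ) : ℤ) + 1)),
          linkedWhiteCount M ω ((i : ℤ) + 1)))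
      (((linkedMeasure δ lam k).map fun ω =>
        (fun j : Fin L => linkedBlackCount ω ((j : ℤ) + 1),
          fun j : Fin i => linkedWhiteCount M ω (((j : ℕ) : ℤ) + 1))).prod
        (siteLaw (δ / 2) (lam.map Prod.snd))) := by
  -- A finite window with every black site that can influence the counts at the sites 1, …, L.
  set D : Finset ℤ := Finset.Icc (-(L + M.natAbs + k : ℤ)) (L + M.natAbs + k)
  have hD1 (j : Fin L) : (j : ℤ) + 1 ∈ D := by
    have := j.2; simp only [D, Finset.mem_Icc]; omega
  have hD2 (t : ℕ) (ht : t < L) (j : Fin k) : (t : ℤ) + 1 - (M + (j : ℤ)) ∈ D := by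
    have := j.2; simp only [D, Finset.mem_Icc]; omega
  set e : D × (Fin k × (A × A)) → ℤ × (Fin k × (A × A)) := fun p => (p.1, p.2)
  have he : Function.Injective e := fun p p' h => by
    simp only [e, Prod.mk.injEq] at h
    exact Prod.ext (Subtype.ext h.1) h.2
  set N : LinkedConfig A k → (D × (Fin k × (A × A)) → ℕ) := fun ω p => linkedMarks ω (e p).1 (e p).2
  have hN : Measurable N := measurable_pi_lambda _ fun p =>
    (measurable_pi_apply _).comp (measurable_linkedMarks _)
  set vB : D × (Fin k × (A × A)) → Fin L → A → ℕ := fun p j =>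
    if (p.1 : ℤ) = (j : ℤ) + 1 then Pi.single p.2.2.1 1 else 0 with hvB
  set vW : ℕ → D × (Fin k × (A × A)) → A → ℕ := fun t p =>
    if (p.1 : ℤ) = (t : ℤ) + 1 - (M + (p.2.1 : ℤ)) then Pi.single p.2.2.2 1 else 0 with hvW
  have hB (ω : LinkedConfig A k) :
      (fun j : Fin L => linkedBlackCount ω ((j : ℤ) + 1)) = weightedSum vB (N ω) := by
    funext j
    rw [linkedBlackCount_eq, weightedSum_apply, Finset.sum_apply,
      Fintype.sum_prod_type (fun p => (N ω p • vB p) j),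
      Finset.sum_eq_single (⟨_, hD1 j⟩ : D)]
    · refine Finset.sum_congr rfl fun m _ => ?_
      simp [hvB, N, e]
    · intro x _ hx
      refine Finset.sum_eq_zero fun m _ => ?_
      have : (x : ℤ) ≠ (j : ℤ) + 1 := fun h => hx (Subtype.ext h)
      simp [hvB, this]
    · simp
  have hW (t : ℕ) (ht : t < L) (ω : LinkedConfig A k) :
      linkedWhiteCount M ω ((t : ℤ) + 1) = weightedSum (vW t) (N ω) := by
    rw [linkedWhiteCount_eq, weightedSum_apply,
      Fintype.sum_prod_type_right (fun p => N ω p • vW t p)]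
    refine Finset.sum_congr rfl fun m _ => ?_
    rw [Finset.sum_eq_single (⟨_, hD2 t ht m.1⟩ : D)]
    · simp [hvW, N, e]
    · intro x _ hx
      have : (x : ℤ) ≠ (t : ℤ) + 1 - (M + (m.1 : ℤ)) := fun h => hx (Subtype.ext h)
      simp [hvW, this]
    · simp
  set v : D × (Fin k × (A × A)) → (Fin L → A → ℕ) × (Fin i → A → ℕ) :=
    fun p => (vB p, fun j => vW j p) with hv
  have hH (ω : LinkedConfig A k) : (fun j : Fin L => linkedBlackCount ω ((j : ℤ) + 1),
      fun j : Fin i => linkedWhiteCount M ω (((j : ℕ) : ℤ) + 1)) = weightedSum v (N ω) := by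
    rw [hB, weightedSum_apply, weightedSum_apply]
    refine Prod.ext ?_ (funext fun j => (hW j (j.2.trans hi) ω).trans ?_)
    · simp [hv, Prod.fst_sum]
    · simp [hv, Prod.snd_sum, weightedSum_apply]
  simp_rw [hH, hW i hi]
  have hlaw := map_linkedMarks lam δ he
  have key := close_map_prod (fun p : D × (Fin k × (A × A)) => δ / 2 *
      (((PMF.uniformOfFintype (Fin k)).toMeasure.prod lam) {(e p).2}).toNNReal) lam k
    (div_ne_zero hδ two_ne_zero)
    -- The black site from which index j leads to i + 1, combined with index j': the white partner
    -- lies at i + 1 + (j' - j).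
    (d := fun j j' l => (⟨_, hD2 i hi j⟩, (j', l))) (fun p p' h => by
      simp only [Prod.mk.injEq, Subtype.mk.injEq] at h
      obtain ⟨h1, h2, h3⟩ := h
      have : p.1 = p'.1 := by ext; omega
      exact Prod.ext this (Prod.ext h2 h3))
    (fun j j' l => rfl) (weightedSum v) (weightedSum (vW i)) (fun l => Pi.single l.2 1)
    -- The black particle is the same for j and j', and in both cases the white one falls at i + 1
    -- or later, outside the sites recorded in the past.
    (fun j j' l hj => by
      rw [weightedSum_single, weightedSum_single]
      refine Prod.ext rfl (funext fun t => ?_)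
      have ht := t.2
      simp only [hv, hvW]
      rw [if_neg (by omega), if_neg (by omega)])
    (fun j l => by simp [weightedSum_single, hvW])
    (fun p hp => by
      rw [weightedSum_single]
      refine if_neg fun h => hp p.2.1 p.2.2 ?_
      exact Prod.ext (Subtype.ext h) rfl)
  rw [← hlaw, Measure.map_map .of_discrete hN, Measure.map_map .of_discrete hN] at key
  rw [siteLaw, Measure.map_map .of_discrete .of_discrete]
  exact key

theorem map_linkedBlackCount (δ : ℝ≥0) (L : ℕ) :
    (linkedMeasure δ lam k).map (fun ω (j : Fin L) => linkedBlackCount ω ((j : ℤ) + 1)) =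
      Measure.pi fun _ : Fin L => siteLaw (δ / 2) (lam.map Prod.fst) := by
  set f : ℕ × (ℕ → Fin k × (A × A)) → A → ℕ := fun y =>
    ∑ i ∈ Finset.range y.1, (Pi.single (y.2 i).2.1 1 : A → ℕ)
  have hs : Measurable fun m : Fin k × (A × A) => (Pi.single m.2.1 1 : A → ℕ) := .of_discrete
  have hf : Measurable f := measurable_sum_range hs
  have hcount (ω : LinkedConfig A k) (x : ℤ) : linkedBlackCount ω x = f (ω x) := by
    funext a
    simp only [linkedBlackCount, Finset.card_filter, f, Finset.sum_apply, Pi.single_apply, eq_comm]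
  simp_rw [hcount]
  refine (map_infinitePi_block _ hf L).trans ?_
  congr 1
  funext _
  have hmap := map_sum_poisson_prod (δ / 2) ((PMF.uniformOfFintype (Fin k)).toMeasure.prod lam) hs
  rw [siteLaw]
  refine hmap.trans ?_
  congr 1
  have hsnd : ((PMF.uniformOfFintype (Fin k)).toMeasure.prod lam).map Prod.snd = lam := by
    rw [Measure.map_snd_prod, measure_univ, one_smul]
  conv_rhs => rw [← hsnd]
  rw [Measure.map_map .of_discrete .of_discrete, Measure.map_map .of_discrete .of_discrete]
  rfl

theorem dBar_xiLaw_zetaLaw_le (δ : ℝ≥0) (hδ : δ ≠ 0) (M : ℤ) (PB PW : Measure A)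
    [IsProbabilityMeasure PB] [IsProbabilityMeasure PW] (hlam : IsJoining lam PB PW) :
    dBar (xiLaw δ PB PW) (zetaLaw δ lam M k) ≤
      2 * ((δ / 2 : ℝ≥0) * columnError (δ / 2) lam k) := by
  refine iSup₂_le fun L hL => ?_
  have hB : Measurable fun (ω : LinkedConfig A k) (j : Fin L) =>
      linkedBlackCount ω ((j : ℤ) + 1) :=
    measurable_pi_lambda _ fun j => measurable_linkedBlackCount _
  have hW (i : ℕ) := measurable_linkedWhiteCount (A := A) (k := k) M ((i : ℤ) + 1)
  refine dBarBlock_le_of_sequence hL (linkedMeasure δ lam k) hB hW (siteLaw (δ / 2) PW) _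
    (fun i hi => ?_) ?_ ?_
  · have := close_linkedCounts lam δ hδ M hi (k := k)
    simp_rw [hlam.map_snd] at this
    exact this
  · rw [map_linkedBlackCount, blockLaw_xiLaw]
    simp_rw [hlam.map_fst]
  · have hc : Measurable (linkedCounts M : LinkedConfig A k → ℤ → SiteCounts A) :=
      measurable_pi_lambda _ fun x =>
        (measurable_linkedBlackCount x).prodMk (measurable_linkedWhiteCount M x)
    have hBW : Measurable fun ω : LinkedConfig A k =>
        (fun j : Fin L => linkedBlackCount ω ((j : ℤ) + 1),
          fun j : Fin L => linkedWhiteCount M ω (((j : ℕ) : ℤ) + 1)) :=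
      hB.prodMk (measurable_pi_lambda _ fun j => hW j)
    rw [blockLaw, zetaLaw, Measure.map_map (by fun_prop) hc, Measure.map_map .of_discrete hBW]
    rfl

end Zeta

end ParticlePairs

/-! ### Conclusion: the bound, uniform in the block length, tends to 0. -/

theorem mainTheorem2 {A : Type*} [Finite A] [MeasurableSpace A] [DiscreteMeasurableSpace A]
    (PB PW : MeasureTheory.Measure A)
    [MeasureTheory.IsProbabilityMeasure PB] [MeasureTheory.IsProbabilityMeasure PW]
    (lam : MeasureTheory.Measure (A × A)) [MeasureTheory.IsProbabilityMeasure lam]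
    (hlam : ParticlePairs.IsJoining lam PB PW)
    (δ : NNReal) (hδ : 0 < δ) (M : ℤ) (ε : ℝ) (hε : 0 < ε) :
    ∃ K : ℕ, ∀ (k : ℕ) [NeZero k], K ≤ k →
      ParticlePairs.dBar (ParticlePairs.xiLaw δ PB PW) (ParticlePairs.zetaLaw δ lam M k)
        < ENNReal.ofReal ε := by
  classical
  have := Fintype.ofFinite A
  have h : Filter.Tendsto
      (fun k : ℕ => 2 * (((δ / 2 : ℝ≥0) : ℝ≥0∞) * ParticlePairs.columnError (δ / 2) lam k))
      Filter.atTop (nhds 0) := by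
    have h1 := ENNReal.Tendsto.const_mul (a := ((δ / 2 : ℝ≥0) : ℝ≥0∞))
      (ParticlePairs.tendsto_columnError (δ / 2) lam) (.inr ENNReal.coe_ne_top)
    have h2 := ENNReal.Tendsto.const_mul (a := 2) h1 (.inr ENNReal.ofNat_ne_top)
    rwa [mul_zero, mul_zero] at h2
  obtain ⟨K, hK⟩ := Filter.eventually_atTop.1
    (h.eventually_lt_const (ENNReal.ofReal_pos.2 hε))
  exact ⟨K, fun k _ hk =>
    (ParticlePairs.dBar_xiLaw_zetaLaw_le lam δ hδ.ne' M PB PW hlam).trans_lt (hK k hk)⟩
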